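/- **Setting.** A network of $N$ nodes is given by an undirected graph and a doubly stochastic primitive matrix $W=(w_{ij})\in\mathbb R^{N\times N}$ (some power $W^k$, $k\ge1$, has only positive entries) with $w_{ij}=0$ unless $j$ belongs to the neighbourhood $\mathcal N_i$ of $i$ (which contains $i$). Node $i$ holds a symmetric positive semidefinite matrix $M_i\in\mathbb R^{d\times d}$, and $M=\sum_{i=1}^N M_i$ has eigenvalues $\lambda_1\ge\dots\ge\lambda_r>\lambda_{r+1}\ge\dots\ge\lambda_d$, where $1\le r<d$. The columns of $Q\in\mathbb R^{d\times r}$ are an orthonormal basis of the span of eigenvectors for $\lambda_1,\dots,\lambda_r$. QR factorizations have an orthonormal first factor and an upper triangular second factor with nonnegative diagonal; $e_1,\dots,e_N$ is the standard basis of $\mathbb R^N$, and $\|\cdot\|_2$ is the Euclidean norm of a vector and the operator 2-norm of a matrix. *Orthogonal iteration (OI):* $Q_c^{(0)}=Q_{\rm init}$ and $MQ_c^{(t-1)}=Q_c^{(t)}R_c^{(t)}$ (QR) for $t\ge1$. *S-DOT / SA-DOT:* $Q_{s,i}^{(0)}=Q_{\rm init}$ for all $i$. In outer iteration $t\ge1$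 put $Z_i^{(0)}=M_iQ_{s,i}^{(t-1)}$, perform $T_{c,t}$ rounds $Z_i^{(k)}=\sum_{j\in\mathcal N_i}w_{ij}Z_j^{(k-1)}$, put $V_{s,i}^{(t)}=Z_i^{(T_{c,t})}/[W^{T_{c,t}}e_1]_i$, and let $V_{s,i}^{(t)}=Q_{s,i}^{(t)}R_{s,i}^{(t)}$ be a QR factorization. S-DOT uses a constant $T_{c,t}=T_c$; SA-DOT uses $T_{c,1}<T_{c,2}<\dots<T_{c,T_o}$. Let $T_o\ge1$ and put $\alpha=\sum_i\|M_i\|_2$, $\gamma=(\sum_i\|M_i\|_2^2)^{1/2}$, $\beta=\max_{1\le t\le T_o}\|(R_c^{(t)})^{-1}\|_2$ and $$\tau_{\rm mix}=\max_i\,\inf\{t\in\mathbb N:\ \|e_i^{\mathsf T}W^t-\tfrac1N\mathbf 1^{\mathsf T}\|_2\le\tfrac12\}.$$ **Theorem.** Let $Q_{\rm init}\in\mathbb R^{d\times r}$ have orthonormal columns, and suppose that the largest principal angle $\theta$ between the column spaces of $Q$ and $Q_{\rm init}$ satisfies $$\cos\theta=\min_{0\ne u\in{\rm ran}\,Q}\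 \max_{0\ne v\in{\rm ran}\,Q_{\rm init}}\frac{|u^{\mathsf T}v|}{\|u\|_2\|v\|_2}>0 .$$ There are a constant $c>0$ depending only on $\theta$ and a constant $C>0$ depending only on $W$ such that the following holds for all $T_o\ge1$ and $\varepsilon\in(0,1)$. 1. (S-DOT) If $$T_c\ge C\Big(T_o\tau_{\rm mix}\log(3\sqrt r\,\alpha\beta)+T_o\tau_{\rm mix}\log\tfrac1\varepsilon+\tau_{\rm mix}\log\tfrac{\gamma\sqrt{Nr}}{\alpha}\Big),$$ then all the numbers $[W^{T_c}e_1]_i$ are positive and, for every node $i$, $$\|QQ^{\mathsf T}-Q_{s,i}^{(T_o)}(Q_{s,i}^{(T_o)})^{\mathsf T}\|_2\le c\,\Big|\frac{\lambda_{r+1}}{\lambda_r}\Big|^{T_o}+3\,\varepsilon^{T_o}.$$ 2. (SA-DOT) If for every $t=1,\dots,T_o$ $$T_{c,t}\ge C\Big(t\,\tau_{\rm mix}\log(3\sqrt r\,\alpha\beta)+T_o\tau_{\rm mix}\log\tfrac1\varepsilon+\tau_{\rm mix}\log\Big(T_o\frac{\gamma\sqrt{Nr}}{\alpha}\Big)\Big),$$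 then all the numbers $[W^{T_{c,t}}e_1]_i$, $1\le t\le T_o$, are positive and, for every node $i$, $$\|QQ^{\mathsf T}-Q_{s,i}^{(T_o)}(Q_{s,i}^{(T_o)})^{\mathsf T}\|_2\le c\,\Big|\frac{\lambda_{r+1}}{\lambda_r}\Big|^{T_o}+2\,\varepsilon^{T_o}.$$ -/

import Mathlib

open scoped Matrix Matrix.Norms.L2Operator

/-!
Throughout, the norm `‖A‖` of a real matrix is the operator 2-norm (spectral norm), nodes are
indexed by `Fin N`, and iteration counters start at `0` for the initial value.
-/

noncomputable section

namespace DOT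

/-- `Q` and `R` form a QR factorization of `V`: `Q` has orthonormal columns, `R` is upper
triangular with nonnegative diagonal, and `V = Q R`. If `V` has full column rank this is the
unique factorization in which `R` is the Cholesky factor of `Vᵀ V`; for every `V` with at least
as many rows as columns at least one such factorization exists. -/
structure IsQR {d r : ℕ} (V Q : Matrix (Fin d) (Fin r) ℝ) (R : Matrix (Fin r) (Fin r) ℝ) :
    Prop where
  orth : Qᵀ * Q = 1
  upper : ∀ i j : Fin r, j < i → R i j = 0
  diag_nonneg : ∀ i : Fin r, 0 ≤ R i i
  eq : V = Q * R

/-- A run of centralized orthogonal iteration on `M` started at `Qinit`: at iteration `t + 1`,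
`V = M Q⁽ᵗ⁾` is factored as `V = Q⁽ᵗ⁺¹⁾ R⁽ᵗ⁺¹⁾`. -/
structure IsOIRun {d r : ℕ} (M : Matrix (Fin d) (Fin d) ℝ) (Qinit : Matrix (Fin d) (Fin r) ℝ)
    (Q : ℕ → Matrix (Fin d) (Fin r) ℝ) (R : ℕ → Matrix (Fin r) (Fin r) ℝ) : Prop where
  init : Q 0 = Qinit
  step : ∀ t, IsQR (M * Q t) (Q (t + 1)) (R (t + 1))

open Classical in
/-- `k` rounds of consensus averaging over the network `G` with weights `W`: in each round node
`i` replaces its matrix by `∑ w i j Z j` over its neighbourhood, which includes `i` itself. -/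
def consensus {N d r : ℕ} (G : SimpleGraph (Fin N)) (W : Matrix (Fin N) (Fin N) ℝ)
    (Z : Fin N → Matrix (Fin d) (Fin r) ℝ) : ℕ → Fin N → Matrix (Fin d) (Fin r) ℝ
  | 0 => Z
  | k + 1 => fun i => ∑ j with j = i ∨ G.Adj i j, W i j • consensus G W Z k j

/-- The normalizer `[Wᵏ e₁]ᵢ`, with `e₁` the first standard basis vector. -/
def normalizer {N : ℕ} [NeZero N] (W : Matrix (Fin N) (Fin N) ℝ) (k : ℕ) (i : Fin N) : ℝ :=
  ((W ^ k) *ᵥ (Pi.single (0 : Fin N) (1 : ℝ))) i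

/-- A run of the sample-wise distributed orthogonal iteration with local matrices `M i`, network
`G`, weights `W` and `Tc t` consensus rounds in outer iteration `t ≥ 1`, started at `Qinit` at
every node. `Q t i` and `R t i` are the QR factors at node `i` after outer iteration `t`. -/
structure IsDistributedRun {N d r : ℕ} [NeZero N] (G : SimpleGraph (Fin N))
    (W : Matrix (Fin N) (Fin N) ℝ) (M : Fin N → Matrix (Fin d) (Fin d) ℝ) (Tc : ℕ → ℕ)
    (Qinit : Matrix (Fin d) (Fin r) ℝ)
    (Q : ℕ → Fin N → Matrix (Fin d) (Fin r) ℝ)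
    (R : ℕ → Fin N → Matrix (Fin r) (Fin r) ℝ) : Prop where
  init : ∀ i, Q 0 i = Qinit
  step : ∀ t i,
    IsQR ((normalizer W (Tc (t + 1)) i)⁻¹ •
        consensus G W (fun j => M j * Q t j) (Tc (t + 1)) i)
      (Q (t + 1) i) (R (t + 1) i)

/-- S-DOT: the same number `Tc` of consensus rounds in every outer iteration. -/
def IsSDOTRun {N d r : ℕ} [NeZero N] (G : SimpleGraph (Fin N))
    (W : Matrix (Fin N) (Fin N) ℝ) (M : Fin N → Matrix (Fin d) (Fin d) ℝ) (Tc : ℕ)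
    (Qinit : Matrix (Fin d) (Fin r) ℝ)
    (Q : ℕ → Fin N → Matrix (Fin d) (Fin r) ℝ)
    (R : ℕ → Fin N → Matrix (Fin r) (Fin r) ℝ) : Prop :=
  IsDistributedRun G W M (fun _ => Tc) Qinit Q R

/-- SA-DOT with `To` outer iterations: the numbers of consensus rounds are strictly increasing,
`Tc 1 < Tc 2 < ⋯ < Tc To`. -/
def IsSADOTRun {N d r : ℕ} [NeZero N] (G : SimpleGraph (Fin N))
    (W : Matrix (Fin N) (Fin N) ℝ) (M : Fin N → Matrix (Fin d) (Fin d) ℝ) (To : ℕ) (Tc : ℕ → ℕ)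
    (Qinit : Matrix (Fin d) (Fin r) ℝ)
    (Q : ℕ → Fin N → Matrix (Fin d) (Fin r) ℝ)
    (R : ℕ → Fin N → Matrix (Fin r) (Fin r) ℝ) : Prop :=
  StrictMonoOn Tc (Set.Icc 1 To) ∧ IsDistributedRun G W M Tc Qinit Q R

/-- The mixing time `max_i inf {t : ‖eᵢᵀ Wᵗ - (1/N) 1ᵀ‖₂ ≤ 1/2}`. -/
def mixingTime {N : ℕ} (W : Matrix (Fin N) (Fin N) ℝ) : ℕ :=
  ⨆ i : Fin N, sInf {t : ℕ | Real.sqrt (∑ j, ((W ^ t) i j - 1 / (N : ℝ)) ^ 2) ≤ 1 / 2}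

/-- `lam` lists the eigenvalues of `M` with multiplicity in nonincreasing order, and the columns
of `U` are corresponding orthonormal eigenvectors. -/
structure IsEigensystem {d : ℕ} (M : Matrix (Fin d) (Fin d) ℝ) (lam : Fin d → ℝ)
    (U : Matrix (Fin d) (Fin d) ℝ) : Prop where
  orth : Uᵀ * U = 1
  eig : M * U = U * Matrix.diagonal lam
  anti : Antitone lam

/-- The columns of `Q` are an orthonormal basis of the span of the first `r` columns of `U`. -/
structure IsPrincipalBasis {d r : ℕ} (U : Matrix (Fin d) (Fin d) ℝ)
    (Q : Matrix (Fin d) (Fin r) ℝ) : Prop where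
  orth : Qᵀ * Q = 1
  span_eq : Submodule.span ℝ (Set.range fun k : Fin r => Q.col k) =
    Submodule.span ℝ ((fun k : Fin d => U.col k) '' {k | (k : ℕ) < r})

/-- The Euclidean norm of a coordinate vector. -/
def vecNorm {d : ℕ} (v : Fin d → ℝ) : ℝ := Real.sqrt (v ⬝ᵥ v)

/-- The cosine of the largest principal angle between the column spaces of `Q` and `P`:
`min_u max_v |uᵀ v| / (‖u‖₂ ‖v‖₂)` over nonzero `u = Q x` and nonzero `v = P y`
(for `Q`, `P` with linearly independent columns). -/
def cosAngle {d r : ℕ} (Q P : Matrix (Fin d) (Fin r) ℝ) : ℝ :=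
  ⨅ x : {x : Fin r → ℝ // x ≠ 0}, ⨆ y : {y : Fin r → ℝ // y ≠ 0},
    |(Q *ᵥ x.1) ⬝ᵥ (P *ᵥ y.1)| / (vecNorm (Q *ᵥ x.1) * vecNorm (P *ᵥ y.1))

/-- `α = ∑ᵢ ‖Mᵢ‖₂`. -/
def alpha {N d : ℕ} (M : Fin N → Matrix (Fin d) (Fin d) ℝ) : ℝ := ∑ i, ‖M i‖

/-- `γ = (∑ᵢ ‖Mᵢ‖₂²)^(1/2)`. -/
def gamma {N d : ℕ} (M : Fin N → Matrix (Fin d) (Fin d) ℝ) : ℝ := Real.sqrt (∑ i, ‖M i‖ ^ 2)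

/-- `β = max_{t = 1, …, To} ‖(R⁽ᵗ⁾)⁻¹‖₂`. -/
def beta {r : ℕ} (R : ℕ → Matrix (Fin r) (Fin r) ℝ) (To : ℕ) : ℝ :=
  ⨆ t : Fin To, ‖(R ((t : ℕ) + 1))⁻¹‖

end DOT

end

/-! Each node is regarded as running inexact orthogonal iteration for `∑ i, M i`, and its angle to
ran Q is tracked directly, without comparison with the centralized iterates. Write a = λ_r, b =
λ_{r+1}, q = b/a, s = cos θ, κ = 3√r αβ, n = T_o.

An exact step multiplies the tangent of the largest angle to ran Q by at most q. A distributed step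
at node i has two errors. Consensus returns ∑ M_j X_j only up to δα, with δ = 4Ne and e the
entrywise distance of W^k from averaging (`consensus_error`). Moreover the X_j differ from X_i. This
disagreement does not accumulate: all nodes factor matrices near the same ∑ M_j X_j, so stability of
QR (`IsQR.norm_sub_le`) bounds it by a fixed multiple of δ at every step. Hence the tangent after t
steps is at most (1+2m)^t (q^t/s + tm), with m a multiple of r s⁻² (α/a)² δ
(`tanLe_of_inexact_iteration`), and `TanLe.norm_proj_sub_le` passes to projections.

The number of rounds may not involve s, although m does. Through its first term alone, β bounds the
smallest singular value of M Q_init below by 1/β; this yields α/a ≤ αβ and κ(2s+q) ≥ 3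
(`IsOIRun.condition_bounds`). If n ≤ 1/s and s ≤ q, the trivial bound 2 is already below c(s) q^n.
Otherwise 1/s ≤ κn, and δ ≤ ε^n/(κn)^11 suffices (`accumulated_error_le`). Geometric mixing
(`exists_mixing_rate`) achieves this within a constant times log κ + n log(1/ε) + log n rounds. The
mixing time and γ enter only through τ ≥ 1 (for N ≥ 2; one node averages exactly) and γ√(Nr)/α ≥ 1.
-/

namespace DOT

/-! ### Euclidean norm of coordinate vectors and the spectral norm -/

section VecNorm

variable {d r n : ℕ}

lemma vecNorm_eq_norm (v : Fin d → ℝ) : vecNorm v = ‖WithLp.toLp 2 v‖ := by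
  rw [EuclideanSpace.norm_eq, vecNorm, dotProduct]
  simp [pow_two]

lemma vecNorm_nonneg (v : Fin d → ℝ) : 0 ≤ vecNorm v := Real.sqrt_nonneg _

lemma vecNorm_sq (v : Fin d → ℝ) : vecNorm v ^ 2 = v ⬝ᵥ v :=
  Real.sq_sqrt (by simpa using dotProduct_star_self_nonneg v)

@[simp] lemma vecNorm_zero : vecNorm (0 : Fin d → ℝ) = 0 := by simp [vecNorm]

lemma vecNorm_eq_zero {v : Fin d → ℝ} : vecNorm v = 0 ↔ v = 0 := by
  rw [vecNorm_eq_norm, norm_eq_zero]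
  exact WithLp.toLp_eq_zero 2

lemma vecNorm_pos {v : Fin d → ℝ} (hv : v ≠ 0) : 0 < vecNorm v :=
  lt_of_le_of_ne (vecNorm_nonneg v) (fun h => hv (vecNorm_eq_zero.1 h.symm))

lemma vecNorm_add_le (v w : Fin d → ℝ) : vecNorm (v + w) ≤ vecNorm v + vecNorm w := by
  simp only [vecNorm_eq_norm, WithLp.toLp_add]
  exact norm_add_le _ _

lemma vecNorm_sub_le (v w : Fin d → ℝ) : vecNorm (v - w) ≤ vecNorm v + vecNorm w := by
  simp only [vecNorm_eq_norm, WithLp.toLp_sub]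
  exact norm_sub_le _ _

lemma vecNorm_sub_comm (v w : Fin d → ℝ) : vecNorm (v - w) = vecNorm (w - v) := by
  simp only [vecNorm_eq_norm, WithLp.toLp_sub]
  exact norm_sub_rev _ _

lemma vecNorm_le_add_sub (v w : Fin d → ℝ) : vecNorm v ≤ vecNorm w + vecNorm (v - w) := by
  simpa using vecNorm_add_le w (v - w)

lemma abs_dotProduct_le (v w : Fin d → ℝ) : |v ⬝ᵥ w| ≤ vecNorm v * vecNorm w := by
  have h := abs_real_inner_le_norm (WithLp.toLp 2 v) (WithLp.toLp 2 w)
  rw [EuclideanSpace.inner_toLp_toLp, dotProduct_comm] at h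
  simpa [vecNorm_eq_norm] using h

lemma abs_apply_le_vecNorm (v : Fin d → ℝ) (i : Fin d) : |v i| ≤ vecNorm v := by
  rw [vecNorm_eq_norm]
  simpa using PiLp.norm_apply_le (WithLp.toLp 2 v) i

lemma vecNorm_mulVec_le (A : Matrix (Fin d) (Fin r) ℝ) (x : Fin r → ℝ) :
    vecNorm (A *ᵥ x) ≤ ‖A‖ * vecNorm x := by
  simpa [vecNorm_eq_norm] using A.l2_opNorm_mulVec (WithLp.toLp 2 x)

lemma norm_le_of_vecNorm_le (A : Matrix (Fin d) (Fin r) ℝ) {c : ℝ} (hc : 0 ≤ c)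
    (h : ∀ x, vecNorm (A *ᵥ x) ≤ c * vecNorm x) : ‖A‖ ≤ c := by
  rw [Matrix.l2_opNorm_def]
  refine ContinuousLinearMap.opNorm_le_bound _ hc fun x => ?_
  have := h x.ofLp
  rw [vecNorm_eq_norm, vecNorm_eq_norm] at this
  exact this

lemma norm_transpose (A : Matrix (Fin d) (Fin r) ℝ) : ‖Aᵀ‖ = ‖A‖ := by
  rw [← Matrix.l2_opNorm_conjTranspose A, Matrix.conjTranspose_eq_transpose_of_trivial]

lemma dotProduct_mulVec_transpose (A : Matrix (Fin d) (Fin r) ℝ) (x : Fin r → ℝ)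
    (y : Fin d → ℝ) : (A *ᵥ x) ⬝ᵥ y = x ⬝ᵥ (Aᵀ *ᵥ y) := by
  rw [Matrix.dotProduct_mulVec, Matrix.vecMul_transpose]

lemma vecNorm_mulVec_of_orth {X : Matrix (Fin d) (Fin r) ℝ} (hX : Xᵀ * X = 1) (x : Fin r → ℝ) :
    vecNorm (X *ᵥ x) = vecNorm x := by
  rw [vecNorm, vecNorm, dotProduct_mulVec_transpose, Matrix.mulVec_mulVec, hX, Matrix.one_mulVec]

lemma norm_le_one_of_orth {X : Matrix (Fin d) (Fin r) ℝ} (hX : Xᵀ * X = 1) : ‖X‖ ≤ 1 :=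
  norm_le_of_vecNorm_le X zero_le_one fun x => by rw [vecNorm_mulVec_of_orth hX, one_mul]

lemma vecNorm_transpose_mulVec_le {X : Matrix (Fin d) (Fin r) ℝ} (hX : Xᵀ * X = 1)
    (v : Fin d → ℝ) : vecNorm (Xᵀ *ᵥ v) ≤ vecNorm v := by
  refine (vecNorm_mulVec_le _ _).trans ?_
  rw [norm_transpose]
  exact mul_le_of_le_one_left (vecNorm_nonneg v) (norm_le_one_of_orth hX)

lemma abs_entry_le_norm (A : Matrix (Fin d) (Fin r) ℝ) (i : Fin d) (j : Fin r) :
    |A i j| ≤ ‖A‖ := by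
  have h1 : A i j = (A *ᵥ Pi.single j 1) i := by simp
  have h2 : vecNorm (Pi.single j (1 : ℝ) : Fin r → ℝ) = 1 := by simp [vecNorm]
  rw [h1]
  refine (abs_apply_le_vecNorm _ i).trans ((vecNorm_mulVec_le _ _).trans ?_)
  rw [h2, mul_one]

lemma vecNorm_le_of_abs_le (v : Fin d → ℝ) {c : ℝ} (hc : 0 ≤ c) (h : ∀ i, |v i| ≤ c) :
    vecNorm v ≤ Real.sqrt d * c := by
  rw [vecNorm, ← Real.sqrt_sq hc, ← Real.sqrt_mul (by positivity)]
  refine Real.sqrt_le_sqrt ?_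
  calc v ⬝ᵥ v = ∑ i, v i * v i := rfl
    _ ≤ ∑ _i : Fin d, c ^ 2 := Finset.sum_le_sum fun i _ => by
        rw [← pow_two, ← sq_abs]
        exact pow_le_pow_left₀ (abs_nonneg _) (h i) 2
    _ = d * c ^ 2 := by simp

lemma norm_le_of_abs_entry_le (A : Matrix (Fin r) (Fin r) ℝ) {c : ℝ} (hc : 0 ≤ c)
    (h : ∀ i j, |A i j| ≤ c) : ‖A‖ ≤ r * c := by
  refine norm_le_of_vecNorm_le A (by positivity) fun x => ?_
  have h1 : ∀ i, |(A *ᵥ x) i| ≤ Real.sqrt r * c * vecNorm x := fun i =>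
    (abs_dotProduct_le (A i) x).trans
      (mul_le_mul_of_nonneg_right (vecNorm_le_of_abs_le (A i) hc (h i)) (vecNorm_nonneg x))
  refine (vecNorm_le_of_abs_le _ (by have := vecNorm_nonneg x; positivity) h1).trans (le_of_eq ?_)
  have := Real.mul_self_sqrt (Nat.cast_nonneg (α := ℝ) r)
  linear_combination c * vecNorm x * this

/-- A lower bound on a square matrix is also a lower bound on its transpose. -/
lemma lower_bound_transpose (A : Matrix (Fin r) (Fin r) ℝ) {s : ℝ} (hs : 0 < s)
    (h : ∀ x, s * vecNorm x ≤ vecNorm (A *ᵥ x)) (y : Fin r → ℝ) :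
    s * vecNorm y ≤ vecNorm (Aᵀ *ᵥ y) := by
  have hinj : Function.Injective A.mulVec := by
    intro x y hxy
    have h0 : A *ᵥ (x - y) = 0 := by rw [Matrix.mulVec_sub]; exact sub_eq_zero.2 hxy
    have h1 := h (x - y)
    rw [h0, vecNorm_zero] at h1
    have h2 := vecNorm_nonneg (x - y)
    exact sub_eq_zero.1 (vecNorm_eq_zero.1 (by nlinarith))
  -- Squareness makes A surjective, so y = Ax; then ‖Ax‖² = x·AᵀAx ≤ ‖x‖ ‖AᵀAx‖, and the bound on A
  -- replaces ‖x‖ by ‖Ax‖/s.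
  obtain ⟨x, rfl⟩ := (Matrix.mulVec_surjective_iff_isUnit.2
    (Matrix.mulVec_injective_iff_isUnit.1 hinj)) y
  have h1 : vecNorm (A *ᵥ x) ^ 2 ≤ vecNorm x * vecNorm (Aᵀ *ᵥ (A *ᵥ x)) := by
    rw [vecNorm_sq, dotProduct_mulVec_transpose]
    exact (le_abs_self _).trans (abs_dotProduct_le _ _)
  have h2 := h x
  have h3 := vecNorm_nonneg (A *ᵥ x)
  have h4 := vecNorm_nonneg (Aᵀ *ᵥ (A *ᵥ x))
  rcases h3.eq_or_lt with h5 | h5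
  · rw [← h5]; simpa using h4
  · have : vecNorm (A *ᵥ x) * (s * vecNorm (A *ᵥ x)) ≤
        vecNorm (A *ᵥ x) * vecNorm (Aᵀ *ᵥ (A *ᵥ x)) := by nlinarith
    exact le_of_mul_le_mul_left this h5

lemma isUnit_of_lower_bound (A : Matrix (Fin r) (Fin r) ℝ)
    (h : ∀ x, A *ᵥ x = 0 → x = 0) : IsUnit A := by
  refine Matrix.mulVec_injective_iff_isUnit.1 fun x y hxy => ?_
  refine sub_eq_zero.1 (h _ ?_)
  rw [Matrix.mulVec_sub]
  exact sub_eq_zero.2 hxy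

end VecNorm

/-! ### Perturbation of QR factorizations -/

section QRStability

variable {d r : ℕ}

lemma IsQR.isUnit {V Q : Matrix (Fin d) (Fin r) ℝ} {R : Matrix (Fin r) (Fin r) ℝ}
    (h : IsQR V Q R) (hV : ∀ x, V *ᵥ x = 0 → x = 0) : IsUnit R :=
  isUnit_of_lower_bound R fun x hx => hV x (by
    rw [h.eq, ← Matrix.mulVec_mulVec, hx, Matrix.mulVec_zero])

lemma IsQR.vecNorm_eq {V Q : Matrix (Fin d) (Fin r) ℝ} {R : Matrix (Fin r) (Fin r) ℝ}
    (h : IsQR V Q R) (x : Fin r → ℝ) : vecNorm (V *ᵥ x) = vecNorm (R *ᵥ x) := by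
  rw [h.eq, ← Matrix.mulVec_mulVec, vecNorm_mulVec_of_orth h.orth]

lemma upper_inv {R : Matrix (Fin r) (Fin r) ℝ} (hR : IsUnit R)
    (hu : ∀ i j : Fin r, j < i → R i j = 0) : ∀ i j : Fin r, j < i → R⁻¹ i j = 0 := by
  let _ := hR.invertible
  have h : Matrix.BlockTriangular R id := fun i j hij => hu i j hij
  have h2 := Matrix.blockTriangular_inv_of_blockTriangular h
  exact fun i j hij => h2 hij

lemma upper_mul_diag {R S : Matrix (Fin r) (Fin r) ℝ}
    (hR : ∀ i j : Fin r, j < i → R i j = 0) (hS : ∀ i j : Fin r, j < i → S i j = 0) (i : Fin r) :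
    (R * S) i i = R i i * S i i := by
  rw [Matrix.mul_apply]
  refine Finset.sum_eq_single i (fun j _ hj => ?_) (by simp)
  rcases lt_or_gt_of_ne hj with h | h
  · rw [hR i j h, zero_mul]
  · rw [hS j i h, mul_zero]

lemma upper_mul {R S : Matrix (Fin r) (Fin r) ℝ}
    (hR : ∀ i j : Fin r, j < i → R i j = 0) (hS : ∀ i j : Fin r, j < i → S i j = 0) :
    ∀ i j : Fin r, j < i → (R * S) i j = 0 := by
  intro i j hij
  rw [Matrix.mul_apply]
  refine Finset.sum_eq_zero fun k _ => ?_
  rcases lt_or_ge k i with h | h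
  · rw [hR i k h, zero_mul]
  · rw [hS k j (hij.trans_le h), mul_zero]

/-- Entrywise stability of the Cholesky factor of a matrix close to the identity. -/
lemma abs_cholesky_sub_one_le {S H : Matrix (Fin r) (Fin r) ℝ} {g : ℝ} (hg : 0 ≤ g)
    (hrg : 12 * (r : ℝ) * g ≤ 1) (hSu : ∀ i j : Fin r, j < i → S i j = 0)
    (hSd : ∀ i, 0 ≤ S i i) (hS : IsUnit S) (hinv : ‖S⁻¹‖ ≤ 12 / 11) (hH : Sᵀ * S = 1 + H)
    (hHn : ‖H‖ ≤ 3 * g) (i j : Fin r) : |(S - 1) i j| ≤ 4 * g := by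
  have hdet : IsUnit S.det := (Matrix.isUnit_iff_isUnit_det S).1 hS
  have hSiu := upper_inv hS hSu
  -- Sᵀ is lower and S⁻¹ upper triangular, so strictly below the diagonal Sᵀ coincides with H S⁻¹,
  -- which is small.
  have hT : Sᵀ = S⁻¹ + H * S⁻¹ := by
    have : Sᵀ * S * S⁻¹ = (1 + H) * S⁻¹ := by rw [hH]
    rwa [Matrix.mul_assoc, Matrix.mul_nonsing_inv _ hdet, Matrix.mul_one, Matrix.add_mul,
      Matrix.one_mul] at this
  have hHS : ‖H * S⁻¹‖ ≤ 36 / 11 * g := by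
    refine (Matrix.l2_opNorm_mul _ _).trans ?_
    calc ‖H‖ * ‖S⁻¹‖ ≤ 3 * g * (12 / 11) := mul_le_mul hHn hinv (norm_nonneg _) (by positivity)
      _ = _ := by ring
  have hoff : ∀ i j : Fin r, i ≠ j → |S i j| ≤ 36 / 11 * g := by
    intro i j hij
    rcases lt_or_gt_of_ne hij with h | h
    · have h1 : S i j = (H * S⁻¹) j i := by
        have := congrFun (congrFun hT j) i
        rwa [Matrix.transpose_apply, Matrix.add_apply, hSiu j i h, zero_add] at this
      rw [h1]
      exact (abs_entry_le_norm _ _ _).trans hHS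
    · rw [hSu i j h, abs_zero]; positivity
  by_cases hij : i = j
  · subst hij
    have h1 : ∑ k, S k i ^ 2 = 1 + H i i := by
      have := congrFun (congrFun hH i) i
      rw [Matrix.mul_apply] at this
      simpa [pow_two] using this
    rw [← Finset.add_sum_erase _ _ (Finset.mem_univ i)] at h1
    have h2 : ∑ k ∈ Finset.univ.erase i, S k i ^ 2 ≤ r * (36 / 11 * g) ^ 2 := by
      calc _ ≤ ∑ k ∈ Finset.univ.erase i, (36 / 11 * g) ^ 2 := by
            refine Finset.sum_le_sum fun k hk => ?_
            rw [← sq_abs]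
            exact pow_le_pow_left₀ (abs_nonneg _) (hoff k i (Finset.ne_of_mem_erase hk)) 2
        _ ≤ ∑ k : Fin r, (36 / 11 * g) ^ 2 :=
            Finset.sum_le_sum_of_subset_of_nonneg (Finset.erase_subset _ _)
              fun _ _ _ => by positivity
        _ = _ := by simp
    have h3 : 0 ≤ ∑ k ∈ Finset.univ.erase i, S k i ^ 2 :=
      Finset.sum_nonneg fun _ _ => sq_nonneg _
    have h4 : |H i i| ≤ 3 * g := (abs_entry_le_norm H i i).trans hHn
    -- The off-diagonal part of a column is of second order, and 12rg ≤ 1 makes it at most g. So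
    -- |S_ii² − 1| ≤ 4g, and S_ii ≥ 0 gives |S_ii − 1| ≤ |S_ii² − 1|.
    have h5 : (r : ℝ) * (36 / 11 * g) ^ 2 ≤ g := by nlinarith
    have h6 := hSd i
    rw [abs_le] at h4 ⊢
    simp only [Matrix.sub_apply, Matrix.one_apply_eq]
    constructor <;> by_contra! h <;> nlinarith [h4.1, h4.2]
  · rw [Matrix.sub_apply, Matrix.one_apply_ne hij, sub_zero]
    exact (hoff i j hij).trans (by linarith)

/-- Lipschitz stability of the orthonormal factor of a QR factorization. -/
lemma IsQR.norm_sub_le {V₁ V₂ Q₁ Q₂ : Matrix (Fin d) (Fin r) ℝ}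
    {R₁ R₂ : Matrix (Fin r) (Fin r) ℝ} (h₁ : IsQR V₁ Q₁ R₁) (h₂ : IsQR V₂ Q₂ R₂)
    (hr : 1 ≤ r) {σ φ : ℝ} (hσ : 0 < σ) (hlow : ∀ x, σ * vecNorm x ≤ vecNorm (V₁ *ᵥ x))
    (hφ : ‖V₂ - V₁‖ ≤ φ) (hsmall : 12 * r * φ ≤ σ) : ‖Q₂ - Q₁‖ ≤ 7 * r * φ / σ := by
  have hr' : (1 : ℝ) ≤ r := by exact_mod_cast hr
  have hφ0 : 0 ≤ φ := (norm_nonneg _).trans hφ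
  set g := φ / σ with hg_def
  have hg : 0 ≤ g := by positivity
  have hrg : 12 * (r : ℝ) * g ≤ 1 := by
    rw [hg_def, ← mul_div_assoc, div_le_one hσ]; exact hsmall
  have hg12 : 12 * g ≤ 1 := by nlinarith
  have hφσ : φ < σ := by nlinarith
  have hU1 : IsUnit R₁ := h₁.isUnit fun x hx => by
    have := hlow x
    rw [hx, vecNorm_zero] at this
    exact vecNorm_eq_zero.1 (by nlinarith [vecNorm_nonneg x])
  have hU2 : IsUnit R₂ := h₂.isUnit fun x hx => by
    have h3 := hlow x
    have h4 := vecNorm_le_add_sub (V₁ *ᵥ x) (V₂ *ᵥ x)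
    have h5 : vecNorm (V₁ *ᵥ x - V₂ *ᵥ x) ≤ φ * vecNorm x := by
      rw [vecNorm_sub_comm, ← Matrix.sub_mulVec]
      exact (vecNorm_mulVec_le _ _).trans (mul_le_mul_of_nonneg_right hφ (vecNorm_nonneg x))
    rw [hx, vecNorm_zero, zero_add, sub_zero] at h4
    rw [hx, sub_zero] at h5
    exact vecNorm_eq_zero.1 (by nlinarith [vecNorm_nonneg x])
  have hd1 : IsUnit R₁.det := (Matrix.isUnit_iff_isUnit_det _).1 hU1
  have hR1i : ‖R₁⁻¹‖ ≤ 1 / σ := norm_le_of_vecNorm_le _ (by positivity) fun x => by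
    have := hlow (R₁⁻¹ *ᵥ x)
    rw [h₁.vecNorm_eq, Matrix.mulVec_mulVec, Matrix.mul_nonsing_inv _ hd1,
      Matrix.one_mulVec] at this
    rw [div_mul_eq_mul_div, one_mul, le_div_iff₀ hσ]
    linarith
  set G := (V₂ - V₁) * R₁⁻¹ with hG
  have hGn : ‖G‖ ≤ g := by
    refine (Matrix.l2_opNorm_mul _ _).trans ?_
    calc _ ≤ φ * (1 / σ) := mul_le_mul hφ hR1i (norm_nonneg _) hφ0
      _ = g := by rw [hg_def]; ring
  -- Normalizing by R₁ reduces to a perturbation of orthonormal columns: Q₂S = Q₁ + G, so S is the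
  -- Cholesky factor of a Gram matrix within 2g + g² of the identity.
  set S := R₂ * R₁⁻¹ with hS_def
  have hQS : Q₂ * S = Q₁ + G := by
    have h3 : V₁ * R₁⁻¹ = Q₁ := by
      rw [h₁.eq, Matrix.mul_assoc, Matrix.mul_nonsing_inv _ hd1, Matrix.mul_one]
    rw [hG, Matrix.sub_mul, h3, hS_def, ← Matrix.mul_assoc, ← h₂.eq]
    abel
  have hSU : IsUnit S := hU2.mul ((Matrix.isUnit_nonsing_inv_iff).2 hU1)
  have hdS : IsUnit S.det := (Matrix.isUnit_iff_isUnit_det _).1 hSU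
  have hR1u := upper_inv hU1 h₁.upper
  have hSlow : ∀ x, 11 / 12 * vecNorm x ≤ vecNorm (S *ᵥ x) := fun x => by
    have h3 := vecNorm_le_add_sub (Q₁ *ᵥ x) (Q₂ *ᵥ (S *ᵥ x))
    have h4 : vecNorm (Q₁ *ᵥ x - Q₂ *ᵥ (S *ᵥ x)) ≤ g * vecNorm x := by
      rw [vecNorm_sub_comm, Matrix.mulVec_mulVec, hQS, ← Matrix.sub_mulVec, add_sub_cancel_left]
      exact (vecNorm_mulVec_le _ _).trans (mul_le_mul_of_nonneg_right hGn (vecNorm_nonneg x))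
    rw [vecNorm_mulVec_of_orth h₁.orth, vecNorm_mulVec_of_orth h₂.orth] at h3
    nlinarith [vecNorm_nonneg x]
  have hSi : ‖S⁻¹‖ ≤ 12 / 11 := norm_le_of_vecNorm_le _ (by positivity) fun x => by
    have := hSlow (S⁻¹ *ᵥ x)
    rw [Matrix.mulVec_mulVec, Matrix.mul_nonsing_inv _ hdS, Matrix.one_mulVec] at this
    linarith
  have hSd : ∀ i, 0 ≤ S i i := fun i => by
    rw [hS_def, upper_mul_diag h₂.upper hR1u]
    refine mul_nonneg (h₂.diag_nonneg i) ?_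
    have h3 := upper_mul_diag h₁.upper hR1u i
    rw [Matrix.mul_nonsing_inv _ hd1, Matrix.one_apply_eq] at h3
    by_contra! h4
    nlinarith [h₁.diag_nonneg i]
  have hn1 := norm_le_one_of_orth h₁.orth
  have hH : Sᵀ * S = 1 + (Q₁ᵀ * G + Gᵀ * Q₁ + Gᵀ * G) := by
    have h3 : Sᵀ * S = (Q₂ * S)ᵀ * (Q₂ * S) := by
      rw [Matrix.transpose_mul Q₂ S, Matrix.mul_assoc, ← Matrix.mul_assoc Q₂ᵀ, h₂.orth,
        Matrix.one_mul]
    rw [h3, hQS, Matrix.transpose_add, Matrix.add_mul, Matrix.mul_add, Matrix.mul_add, h₁.orth]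
    abel
  have hHn : ‖Q₁ᵀ * G + Gᵀ * Q₁ + Gᵀ * G‖ ≤ 3 * g := by
    have e1 : ‖Q₁ᵀ * G‖ ≤ 1 * g := (Matrix.l2_opNorm_mul _ _).trans
      (mul_le_mul (by rwa [norm_transpose]) hGn (norm_nonneg _) zero_le_one)
    have e2 : ‖Gᵀ * Q₁‖ ≤ g * 1 := (Matrix.l2_opNorm_mul _ _).trans
      (mul_le_mul (by rwa [norm_transpose]) hn1 (norm_nonneg _) hg)
    have e3 : ‖Gᵀ * G‖ ≤ g * g := (Matrix.l2_opNorm_mul _ _).trans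
      (mul_le_mul (by rwa [norm_transpose]) hGn (norm_nonneg _) hg)
    have e4 := norm_add₃_le (a := Q₁ᵀ * G) (b := Gᵀ * Q₁) (c := Gᵀ * G)
    nlinarith
  have hSn : ‖S - 1‖ ≤ r * (4 * g) := norm_le_of_abs_entry_le _ (by positivity)
    (abs_cholesky_sub_one_le hg hrg (upper_mul h₂.upper hR1u) hSd hSU hSi hH hHn)
  have hfin : Q₂ - Q₁ = G - Q₂ * (S - 1) := by
    rw [Matrix.mul_sub, hQS, Matrix.mul_one]; abel
  have hQ2 := norm_le_one_of_orth h₂.orth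
  have e5 : ‖Q₂ * (S - 1)‖ ≤ 1 * (r * (4 * g)) := (Matrix.l2_opNorm_mul _ _).trans
    (mul_le_mul hQ2 hSn (norm_nonneg _) zero_le_one)
  rw [hfin, mul_div_assoc]
  refine (_root_.norm_sub_le _ _).trans ?_
  nlinarith

end QRStability

/-! ### Tangents of principal angles and distance of projections -/

section Projector

variable {d r : ℕ}

lemma transpose_mulVec_eq_zero_of_proj {X : Matrix (Fin d) (Fin r) ℝ} (hX : Xᵀ * X = 1)
    (z : Fin d → ℝ) : Xᵀ *ᵥ (z - (X * Xᵀ) *ᵥ z) = 0 := by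
  rw [Matrix.mulVec_sub, Matrix.mulVec_mulVec, ← Matrix.mul_assoc, hX, Matrix.one_mul, sub_self]

lemma vecNorm_sq_eq_add_of_orth {X : Matrix (Fin d) (Fin r) ℝ} (hX : Xᵀ * X = 1)
    (z : Fin d → ℝ) :
    vecNorm z ^ 2 = vecNorm ((X * Xᵀ) *ᵥ z) ^ 2 + vecNorm (z - (X * Xᵀ) *ᵥ z) ^ 2 := by
  have h1 : ((X * Xᵀ) *ᵥ z) ⬝ᵥ (z - (X * Xᵀ) *ᵥ z) = 0 := by
    rw [← Matrix.mulVec_mulVec z X Xᵀ, dotProduct_mulVec_transpose, Matrix.mulVec_mulVec z X Xᵀ,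
      transpose_mulVec_eq_zero_of_proj hX, dotProduct_zero]
  generalize (X * Xᵀ) *ᵥ z = p at h1 ⊢
  have h2 : z = p + (z - p) := by abel
  generalize z - p = w at h1 h2 ⊢
  subst h2
  rw [vecNorm_sq, vecNorm_sq, vecNorm_sq, dotProduct_add, add_dotProduct, add_dotProduct,
    dotProduct_comm w p, h1]
  ring

lemma vecNorm_proj_le {X : Matrix (Fin d) (Fin r) ℝ} (hX : Xᵀ * X = 1) (z : Fin d → ℝ) :
    vecNorm ((X * Xᵀ) *ᵥ z) ≤ vecNorm z := by
  have h := vecNorm_sq_eq_add_of_orth hX z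
  exact abs_le_of_sq_le_sq' (by nlinarith [sq_nonneg (vecNorm (z - (X * Xᵀ) *ᵥ z))])
    (vecNorm_nonneg z) |>.2

lemma vecNorm_sub_proj_le {X : Matrix (Fin d) (Fin r) ℝ} (hX : Xᵀ * X = 1) (z : Fin d → ℝ) :
    vecNorm (z - (X * Xᵀ) *ᵥ z) ≤ vecNorm z := by
  have h := vecNorm_sq_eq_add_of_orth hX z
  exact abs_le_of_sq_le_sq' (by nlinarith [sq_nonneg (vecNorm ((X * Xᵀ) *ᵥ z))])
    (vecNorm_nonneg z) |>.2

/-- All principal angles between the column space of `X` and the range of the orthogonal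
projection `P` have tangent at most `T`. -/
def TanLe (P : Matrix (Fin d) (Fin d) ℝ) (X : Matrix (Fin d) (Fin r) ℝ) (T : ℝ) : Prop :=
  ∀ x, vecNorm (X *ᵥ x - P *ᵥ (X *ᵥ x)) ≤ T * vecNorm (P *ᵥ (X *ᵥ x))

lemma TanLe.mono {P : Matrix (Fin d) (Fin d) ℝ} {X : Matrix (Fin d) (Fin r) ℝ} {T T' : ℝ}
    (h : TanLe P X T) (hT : T ≤ T') : TanLe P X T' := fun x =>
  (h x).trans (mul_le_mul_of_nonneg_right hT (vecNorm_nonneg _))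

/-- The condition depends on the column space only, and an invertible R leaves that space unchanged.
-/
lemma TanLe.of_isQR {P : Matrix (Fin d) (Fin d) ℝ} {V Q : Matrix (Fin d) (Fin r) ℝ}
    {R : Matrix (Fin r) (Fin r) ℝ} {T : ℝ} (h : TanLe P V T) (hqr : IsQR V Q R)
    (hV : ∀ x, V *ᵥ x = 0 → x = 0) : TanLe P Q T := by
  intro x
  have hd : IsUnit R.det := (Matrix.isUnit_iff_isUnit_det _).1 (hqr.isUnit hV)
  have h1 : V *ᵥ (R⁻¹ *ᵥ x) = Q *ᵥ x := by
    rw [hqr.eq, Matrix.mulVec_mulVec, Matrix.mul_assoc, Matrix.mul_nonsing_inv _ hd,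
      Matrix.mul_one]
  rw [← h1]
  exact h _

lemma TanLe.vecNorm_le {P : Matrix (Fin d) (Fin d) ℝ} {X : Matrix (Fin d) (Fin r) ℝ} {T : ℝ}
    (h : TanLe P X T) (hX : Xᵀ * X = 1) (x : Fin r → ℝ) :
    vecNorm x ≤ (1 + T) * vecNorm (P *ᵥ (X *ᵥ x)) := by
  have h1 := vecNorm_le_add_sub (X *ᵥ x) (P *ᵥ (X *ᵥ x))
  rw [vecNorm_mulVec_of_orth hX] at h1
  linarith [h x]

/-- The distance of two orthogonal projections of equal rank is controlled by the tangent of the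
largest principal angle between their ranges. -/
lemma TanLe.norm_proj_sub_le {Q X : Matrix (Fin d) (Fin r) ℝ} {T : ℝ} (hQ : Qᵀ * Q = 1)
    (hX : Xᵀ * X = 1) (hT : 0 ≤ T) (h : TanLe (Q * Qᵀ) X T) :
    ‖Q * Qᵀ - X * Xᵀ‖ ≤ 2 * T := by
  have hU : IsUnit (Qᵀ * X) := isUnit_of_lower_bound _ fun x hx => by
    have h1 := h.vecNorm_le hX x
    rw [← Matrix.mulVec_mulVec _ Q, Matrix.mulVec_mulVec _ Qᵀ, hx, Matrix.mulVec_zero,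
      vecNorm_zero, mul_zero] at h1
    exact vecNorm_eq_zero.1 (le_antisymm h1 (vecNorm_nonneg x))
  refine norm_le_of_vecNorm_le _ (by positivity) fun z => ?_
  set w := z - (X * Xᵀ) *ᵥ z with hw
  -- With P = QQᵀ the difference is P(1−XXᵀ)z − (1−P)XXᵀz. The tangent condition bounds the second
  -- term at once; the first needs the equality of ranks.
  have hdec : (Q * Qᵀ - X * Xᵀ) *ᵥ z =
      (Q * Qᵀ) *ᵥ w - (X *ᵥ (Xᵀ *ᵥ z) - (Q * Qᵀ) *ᵥ (X *ᵥ (Xᵀ *ᵥ z))) := by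
    rw [hw, Matrix.sub_mulVec, Matrix.mulVec_sub, Matrix.mulVec_mulVec z X Xᵀ]
    abel
  have hwz : vecNorm w ≤ vecNorm z := vecNorm_sub_proj_le hX z
  have hXw : Xᵀ *ᵥ w = 0 := transpose_mulVec_eq_zero_of_proj hX z
  have h1 : vecNorm ((Q * Qᵀ) *ᵥ w) ≤ T * vecNorm z := by
    -- Since QᵀX is invertible, Pw = PXx for some x. As w ⊥ Xx, ‖Pw‖² = −w·(1−P)Xx ≤ ‖w‖ T ‖Pw‖.
    obtain ⟨x, hx⟩ := Matrix.mulVec_surjective_iff_isUnit.2 hU (Qᵀ *ᵥ w)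
    have hx2 : (Q * Qᵀ) *ᵥ (X *ᵥ x) = (Q * Qᵀ) *ᵥ w := by
      rw [← Matrix.mulVec_mulVec _ Q Qᵀ, ← Matrix.mulVec_mulVec _ Q Qᵀ, Matrix.mulVec_mulVec _ Qᵀ X]
      rw [hx]
    have h3 := h x
    rw [hx2] at h3
    have h4 : vecNorm ((Q * Qᵀ) *ᵥ w) ^ 2 = -(w ⬝ᵥ (X *ᵥ x - (Q * Qᵀ) *ᵥ w)) := by
      have e1 : w ⬝ᵥ (X *ᵥ x) = 0 := by
        rw [dotProduct_comm, dotProduct_mulVec_transpose, hXw, dotProduct_zero]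
      have e2 : vecNorm ((Q * Qᵀ) *ᵥ w) ^ 2 = w ⬝ᵥ ((Q * Qᵀ) *ᵥ w) := by
        rw [← Matrix.mulVec_mulVec _ Q Qᵀ, vecNorm_mulVec_of_orth hQ, vecNorm_sq,
          dotProduct_comm w, dotProduct_mulVec_transpose Q]
      rw [dotProduct_sub, e1, e2]; ring
    have h5 := (neg_le_abs _).trans (abs_dotProduct_le w (X *ᵥ x - (Q * Qᵀ) *ᵥ w))
    rw [← h4] at h5
    have h6 := vecNorm_nonneg ((Q * Qᵀ) *ᵥ w)
    have h7 := vecNorm_nonneg w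
    rcases h6.eq_or_lt with h8 | h8
    · rw [← h8]; exact mul_nonneg hT (vecNorm_nonneg z)
    · have h9 : vecNorm ((Q * Qᵀ) *ᵥ w) * vecNorm ((Q * Qᵀ) *ᵥ w) ≤
          (T * vecNorm w) * vecNorm ((Q * Qᵀ) *ᵥ w) := by nlinarith
      exact (le_of_mul_le_mul_right h9 h8).trans (mul_le_mul_of_nonneg_left hwz hT)
  have h2 : vecNorm (X *ᵥ (Xᵀ *ᵥ z) - (Q * Qᵀ) *ᵥ (X *ᵥ (Xᵀ *ᵥ z))) ≤ T * vecNorm z := by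
    refine (h _).trans (mul_le_mul_of_nonneg_left ?_ hT)
    refine (vecNorm_proj_le hQ _).trans ?_
    rw [vecNorm_mulVec_of_orth hX]
    exact vecNorm_transpose_mulVec_le hX z
  rw [hdec]
  refine (vecNorm_sub_le _ _).trans ?_
  linarith

lemma norm_proj_sub_le_two {Q X : Matrix (Fin d) (Fin r) ℝ} (hQ : Qᵀ * Q = 1)
    (hX : Xᵀ * X = 1) : ‖Q * Qᵀ - X * Xᵀ‖ ≤ 2 := by
  refine norm_le_of_vecNorm_le _ (by norm_num) fun z => ?_
  rw [Matrix.sub_mulVec]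
  refine (vecNorm_sub_le _ _).trans ?_
  linarith [vecNorm_proj_le hQ z, vecNorm_proj_le hX z]

end Projector

/-! ### Inexact orthogonal iteration at several nodes -/

section PerturbedIteration

variable {N d r : ℕ}

/-- `Q Qᵀ` reduces `M`; on its range `M` is bounded below by `a`, and on the orthogonal
complement it is bounded above by `b`. -/
structure IsDominant (M : Matrix (Fin d) (Fin d) ℝ) (Q : Matrix (Fin d) (Fin r) ℝ)
    (a b : ℝ) : Prop where
  orth : Qᵀ * Q = 1
  low : ∀ x, a * vecNorm ((Q * Qᵀ) *ᵥ x) ≤ vecNorm ((Q * Qᵀ) *ᵥ (M *ᵥ x))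
  high : ∀ x, vecNorm (M *ᵥ x - (Q * Qᵀ) *ᵥ (M *ᵥ x)) ≤ b * vecNorm (x - (Q * Qᵀ) *ᵥ x)

lemma IsDominant.proj_perturbed_ge {M : Matrix (Fin d) (Fin d) ℝ}
    {Q X V : Matrix (Fin d) (Fin r) ℝ} {a b η : ℝ} (hM : IsDominant M Q a b)
    (hV : ‖V - M * X‖ ≤ η) (x : Fin r → ℝ) :
    a * vecNorm ((Q * Qᵀ) *ᵥ (X *ᵥ x)) - η * vecNorm x ≤ vecNorm ((Q * Qᵀ) *ᵥ (V *ᵥ x)) := by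
  have h1 := hM.low (X *ᵥ x)
  have h2 := vecNorm_le_add_sub ((Q * Qᵀ) *ᵥ (M *ᵥ (X *ᵥ x))) ((Q * Qᵀ) *ᵥ (V *ᵥ x))
  rw [← Matrix.mulVec_sub] at h2
  have h3 := vecNorm_proj_le hM.orth (M *ᵥ (X *ᵥ x) - V *ᵥ x)
  have h4 : vecNorm (M *ᵥ (X *ᵥ x) - V *ᵥ x) ≤ η * vecNorm x := by
    rw [vecNorm_sub_comm, Matrix.mulVec_mulVec, ← Matrix.sub_mulVec]
    exact (vecNorm_mulVec_le _ _).trans (mul_le_mul_of_nonneg_right hV (vecNorm_nonneg x))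
  linarith

lemma IsDominant.perturbed_ge {M : Matrix (Fin d) (Fin d) ℝ}
    {Q X V : Matrix (Fin d) (Fin r) ℝ} {a b η A : ℝ} (hM : IsDominant M Q a b) (ha : 0 ≤ a)
    (hA : 0 < A) (hX : ∀ x, vecNorm x ≤ A * vecNorm ((Q * Qᵀ) *ᵥ (X *ᵥ x)))
    (hV : ‖V - M * X‖ ≤ η) (x : Fin r → ℝ) :
    (a / A - η) * vecNorm x ≤ vecNorm (V *ᵥ x) := by
  refine le_trans ?_ ((hM.proj_perturbed_ge hV x).trans (vecNorm_proj_le hM.orth _))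
  have : a / A * vecNorm x ≤ a * vecNorm ((Q * Qᵀ) *ᵥ (X *ᵥ x)) := by
    rw [div_mul_eq_mul_div, div_le_iff₀ hA]
    nlinarith [hX x]
  linarith

/-- Relative to p = ‖PXx‖, the component of Vx off ran Q is at most (bT + ηA)p and the one in ran Q
at least (a − ηA)p; the quotient bounds the new tangent. -/
lemma IsDominant.tanLe_perturbed {M : Matrix (Fin d) (Fin d) ℝ}
    {Q X V : Matrix (Fin d) (Fin r) ℝ} {a b η A T : ℝ} (hM : IsDominant M Q a b)
    (hb : 0 ≤ b) (hη : 0 ≤ η) (hA : 0 ≤ A) (hT : 0 ≤ T)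
    (hX : ∀ x, vecNorm x ≤ A * vecNorm ((Q * Qᵀ) *ᵥ (X *ᵥ x)))
    (hXT : TanLe (Q * Qᵀ) X T) (hV : ‖V - M * X‖ ≤ η) (hlt : η * A < a) :
    TanLe (Q * Qᵀ) V ((b * T + η * A) / (a - η * A)) := by
  intro x
  have hA0 : 0 ≤ b * T := mul_nonneg hb hT
  have h1 := hM.proj_perturbed_ge hV x
  have h2 := hM.high (X *ᵥ x)
  set p := vecNorm ((Q * Qᵀ) *ᵥ (X *ᵥ x)) with hp
  have hp0 : 0 ≤ p := vecNorm_nonneg _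
  have h3 : η * vecNorm x ≤ η * A * p := by
    have := mul_le_mul_of_nonneg_left (hX x) hη
    linarith
  have h4 : vecNorm (V *ᵥ x - (Q * Qᵀ) *ᵥ (V *ᵥ x)) ≤
      vecNorm (M *ᵥ (X *ᵥ x) - (Q * Qᵀ) *ᵥ (M *ᵥ (X *ᵥ x))) + η * vecNorm x := by
    refine (vecNorm_le_add_sub _ (M *ᵥ (X *ᵥ x) - (Q * Qᵀ) *ᵥ (M *ᵥ (X *ᵥ x)))).trans ?_
    refine add_le_add_right ?_ _
    have e1 : V *ᵥ x - (Q * Qᵀ) *ᵥ (V *ᵥ x) - (M *ᵥ (X *ᵥ x) - (Q * Qᵀ) *ᵥ (M *ᵥ (X *ᵥ x))) =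
        (V - M * X) *ᵥ x - (Q * Qᵀ) *ᵥ ((V - M * X) *ᵥ x) := by
      rw [Matrix.sub_mulVec, Matrix.mulVec_sub, ← Matrix.mulVec_mulVec x M X]
      abel
    rw [e1]
    exact (vecNorm_sub_proj_le hM.orth _).trans
      ((vecNorm_mulVec_le _ _).trans (mul_le_mul_of_nonneg_right hV (vecNorm_nonneg x)))
  have h5 : vecNorm (V *ᵥ x - (Q * Qᵀ) *ᵥ (V *ᵥ x)) ≤ (b * T + η * A) * p := by
    have := mul_le_mul_of_nonneg_left (hXT x) hb
    linarith
  have h6 : (a - η * A) * p ≤ vecNorm ((Q * Qᵀ) *ᵥ (V *ᵥ x)) := by linarith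
  have h7 : 0 < a - η * A := by linarith
  rw [div_mul_eq_mul_div, le_div_iff₀ h7]
  rcases hp0.eq_or_lt with h8 | h8
  · rw [← h8, mul_zero] at h5
    have h9 := vecNorm_nonneg (V *ᵥ x - (Q * Qᵀ) *ᵥ (V *ᵥ x))
    have h10 : vecNorm (V *ᵥ x - (Q * Qᵀ) *ᵥ (V *ᵥ x)) = 0 := le_antisymm h5 h9
    rw [h10, zero_mul]
    have := vecNorm_nonneg ((Q * Qᵀ) *ᵥ (V *ᵥ x))
    positivity
  · calc _ ≤ (b * T + η * A) * p * (a - η * A) := mul_le_mul_of_nonneg_right h5 h7.le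
      _ = (b * T + η * A) * ((a - η * A) * p) := by ring
      _ ≤ _ := mul_le_mul_of_nonneg_left h6 (by positivity)

lemma norm_sum_mul_sub_le (M : Fin N → Matrix (Fin d) (Fin d) ℝ)
    (X : Fin N → Matrix (Fin d) (Fin r) ℝ) {Δ : ℝ} (i : Fin N) (h : ∀ j, ‖X j - X i‖ ≤ Δ) :
    ‖∑ j, M j * X j - (∑ j, M j) * X i‖ ≤ alpha M * Δ := by
  rw [Matrix.sum_mul, ← Finset.sum_sub_distrib, alpha, Finset.sum_mul]
  refine norm_sum_le_of_le _ fun j _ => ?_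
  rw [← Matrix.mul_sub]
  exact (Matrix.l2_opNorm_mul _ _).trans (mul_le_mul_of_nonneg_left (h j) (norm_nonneg _))

/-- The closed form dominates the recursion T ↦ (bT + c)/(a − c): each step loses a factor 1/(1−m) ≤
1 + 2m and adds m. -/
lemma tan_step_le {a b q m s c : ℝ} (ha : 0 < a) (hq0 : 0 ≤ q) (hq1 : q ≤ 1) (hm0 : 0 ≤ m)
    (hm4 : m ≤ 1 / 4) (hs : 0 < s) (hbq : b = a * q) (hc : c ≤ a * m) (t : ℕ) :
    (b * ((1 + 2 * m) ^ t * (q ^ t / s + t * m)) + c) / (a - c) ≤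
      (1 + 2 * m) ^ (t + 1) * (q ^ (t + 1) / s + ((t + 1 : ℕ) : ℝ) * m) := by
  set T := (1 + 2 * m) ^ t * (q ^ t / s + t * m) with hT
  have hT0 : 0 ≤ T := by positivity
  have h4 : 0 < a - a * m := by nlinarith
  have hqT : 0 ≤ q * T := by positivity
  have h1 : (b * T + c) / (a - c) ≤ (b * T + a * m) / (a - a * m) := by
    refine div_le_div₀ ?_ (by linarith) h4 (by linarith)
    rw [hbq]
    positivity
  have h2 : (b * T + a * m) / (a - a * m) ≤ (1 + 2 * m) * (q * T + m) := by
    rw [div_le_iff₀ h4, hbq]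
    have h5 : 1 ≤ (1 + 2 * m) * (1 - m) := by nlinarith
    have h6 : 0 ≤ a * (q * T + m) := by positivity
    calc a * q * T + a * m = a * (q * T + m) * 1 := by ring
      _ ≤ a * (q * T + m) * ((1 + 2 * m) * (1 - m)) := mul_le_mul_of_nonneg_left h5 h6
      _ = _ := by ring
  refine h1.trans (h2.trans ?_)
  have e1 : 1 ≤ (1 + 2 * m) ^ t := one_le_pow₀ (by linarith)
  have e2 : q * ((1 + 2 * m) ^ t * (t * m)) ≤ (1 + 2 * m) ^ t * (t * m) :=
    mul_le_of_le_one_left (by positivity) hq1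
  have e3 : m ≤ (1 + 2 * m) ^ t * m := le_mul_of_one_le_left hm0 e1
  have e4 : q * T = (1 + 2 * m) ^ t * (q ^ (t + 1) / s) + q * ((1 + 2 * m) ^ t * (t * m)) := by
    rw [hT]; ring
  rw [pow_succ (1 + 2 * m) t, mul_comm ((1 + 2 * m) ^ t), mul_assoc]
  refine mul_le_mul_of_nonneg_left ?_ (by linarith)
  rw [e4]
  push_cast
  linarith

set_option maxHeartbeats 1000000 in
/-- Inexact orthogonal iteration carried out at several nodes that differ slightly: the tangent
of the angle to the dominant subspace contracts up to an accumulated error. -/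
lemma tanLe_of_inexact_iteration {M : Fin N → Matrix (Fin d) (Fin d) ℝ}
    {Q X₀ : Matrix (Fin d) (Fin r) ℝ} {a b s δ m : ℝ} {n : ℕ}
    (hM : IsDominant (∑ i, M i) Q a b) (hr : 1 ≤ r) (ha : 0 < a) (haα : a ≤ alpha M)
    (hb : 0 ≤ b) (hba : b ≤ a) (hs : 0 < s) (hs1 : s ≤ 1) (hX₀ : X₀ᵀ * X₀ = 1)
    (hs₀ : ∀ x, s * vecNorm x ≤ vecNorm ((Q * Qᵀ) *ᵥ (X₀ *ᵥ x)))
    (hδ : 0 ≤ δ) (hm : m = 29 * r * (4 / s) ^ 2 * (alpha M / a) ^ 2 * δ) (hmn : 4 * n * m ≤ 1)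
    {X V : ℕ → Fin N → Matrix (Fin d) (Fin r) ℝ} {R : ℕ → Fin N → Matrix (Fin r) (Fin r) ℝ}
    (hX : ∀ i, X 0 i = X₀) (hqr : ∀ t i, IsQR (V t i) (X (t + 1) i) (R (t + 1) i))
    (hV : ∀ t < n, ∀ i, ‖V t i - ∑ j, M j * X t j‖ ≤ δ * alpha M) :
    ∀ t ≤ n, (∀ i, (X t i)ᵀ * X t i = 1) ∧
      (∀ i, TanLe (Q * Qᵀ) (X t i) ((1 + 2 * m) ^ t * ((b / a) ^ t / s + t * m))) ∧
      ∀ i j, ‖X t j - X t i‖ ≤ 28 * r * (4 / s) * (alpha M / a) * δ := by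
  have hr' : (1 : ℝ) ≤ r := by exact_mod_cast hr
  set A := 4 / s with hA
  set D := alpha M / a with hD
  have hA4 : 4 ≤ A := by rw [hA, le_div_iff₀ hs]; linarith
  have hD1 : 1 ≤ D := by rw [hD, le_div_iff₀ ha]; linarith
  have hα : alpha M = a * D := by rw [hD]; field_simp
  have hα0 : 0 < alpha M := ha.trans_le haα
  have hm0 : 0 ≤ m := by rw [hm]; positivity
  set q := b / a with hq
  have hq0 : 0 ≤ q := by positivity
  have hq1 : q ≤ 1 := (div_le_one ha).2 hba
  have hbq : b = a * q := by rw [hq]; field_simp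
  intro t
  induction t with
  | zero =>
    intro _
    refine ⟨fun i => by rw [hX]; exact hX₀, fun i x => ?_, fun i j => ?_⟩
    -- The starting tangent is bounded by 1/s, using ‖(1−P)X₀x‖ ≤ ‖x‖ ≤ ‖PX₀x‖/s.
    · rw [hX]
      have h1 := vecNorm_sub_proj_le hM.orth (X₀ *ᵥ x)
      rw [vecNorm_mulVec_of_orth hX₀] at h1
      have h2 := hs₀ x
      refine h1.trans ?_
      simp only [pow_zero, Nat.cast_zero, zero_mul, add_zero, one_mul]
      rw [div_mul_eq_mul_div, one_mul, le_div_iff₀ hs]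
      linarith
    · rw [hX, hX, sub_self, norm_zero]; positivity
  | succ t ih =>
    intro ht
    obtain ⟨ho, hTan, hdis⟩ := ih (by omega)
    have htn : t < n := by omega
    have hn1 : (1 : ℝ) ≤ n := by exact_mod_cast (by omega : 1 ≤ n)
    have htn' : (t : ℝ) ≤ n := by exact_mod_cast htn.le
    have hm4 : m ≤ 1 / 4 := by nlinarith
    set T := (1 + 2 * m) ^ t * (q ^ t / s + t * m) with hT
    have hT0 : 0 ≤ T := by positivity
    -- Bernoulli gives (1−2m)^t ≥ 1 − 2tm ≥ 1/2, and (1+2m)(1−2m) ≤ 1.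
    have hpow : (1 + 2 * m) ^ t ≤ 2 := by
      have h1 : (1 + 2 * m) ^ t * (1 - 2 * m) ^ t ≤ 1 := by
        rw [← mul_pow]
        exact pow_le_one₀ (by nlinarith) (by nlinarith)
      have h2 : 1 + (t : ℝ) * (-(2 * m)) ≤ (1 + -(2 * m)) ^ t :=
        one_add_mul_le_pow (by linarith) t
      rw [← sub_eq_add_neg] at h2
      have h3 : 1 / 2 ≤ (1 - 2 * m) ^ t := by nlinarith
      have h4 : 0 ≤ (1 + 2 * m) ^ t := by positivity
      nlinarith
    have hTA : 1 + T ≤ A := by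
      have h1 : q ^ t / s ≤ 1 / s := div_le_div_of_nonneg_right (pow_le_one₀ hq0 hq1) hs.le
      have h2 : (t : ℝ) * m ≤ 1 / 4 := by nlinarith
      have h3 : T ≤ 2 * (1 / s + 1 / 4) :=
        mul_le_mul hpow (add_le_add h1 h2) (by positivity) (by norm_num)
      have h4 : A = 4 * (1 / s) := by rw [hA]; ring
      have h5 : 1 ≤ 1 / s := by rw [le_div_iff₀ hs]; linarith
      linarith
    -- This is the QR stability bound 7rφ/σ with φ = 2δα and σ = a/(2A). The total error η adds the
    -- consensus error δα to αΔ, whence 29 = 28 + 1 in m.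
    set Δ := 28 * r * A * D * δ with hΔ
    have hΔ0 : 0 ≤ Δ := by positivity
    set η := alpha M * (Δ + δ) with hη
    have hη0 : 0 ≤ η := by positivity
    have hηA : η * A ≤ a * m := by
      have h1 : 1 * 1 ≤ (r : ℝ) * (A * D) :=
        mul_le_mul hr' (by nlinarith) (by norm_num) (by linarith)
      have h2 : A * D * δ * 1 ≤ A * D * δ * (r * (A * D)) :=
        mul_le_mul_of_nonneg_left (by linarith) (by positivity)
      have h3 : η * A = a * (28 * r * A ^ 2 * D ^ 2 * δ + A * D * δ) := by
        rw [hη, hΔ, hα]; ring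
      rw [h3, hm]
      refine mul_le_mul_of_nonneg_left ?_ ha.le
      linarith
    have hX' : ∀ i x, vecNorm x ≤ A * vecNorm ((Q * Qᵀ) *ᵥ (X t i *ᵥ x)) := fun i x =>
      ((hTan i).vecNorm_le (ho i) x).trans
        (mul_le_mul_of_nonneg_right hTA (vecNorm_nonneg _))
    have hVη : ∀ i, ‖V t i - (∑ j, M j) * X t i‖ ≤ η := fun i => by
      have h1 := norm_sum_mul_sub_le M (X t) i (fun j => hdis i j)
      have h2 := hV t htn i
      have h3 := norm_add_le (V t i - ∑ j, M j * X t j) (∑ j, M j * X t j - (∑ j, M j) * X t i)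
      rw [sub_add_sub_cancel] at h3
      rw [hη]
      linarith
    have hηa : η ≤ a / (4 * A) := by
      rw [le_div_iff₀ (by positivity)]
      have := mul_le_mul_of_nonneg_left hm4 ha.le
      linarith
    have hlow : ∀ i x, a / (2 * A) * vecNorm x ≤ vecNorm (V t i *ᵥ x) := fun i x => by
      refine le_trans (mul_le_mul_of_nonneg_right ?_ (vecNorm_nonneg x))
        (hM.perturbed_ge ha.le (by linarith) (hX' i) (hVη i) x)
      have h1 : a / A = a / (2 * A) + 2 * (a / (4 * A)) := by field_simp; ring
      have h2 : 0 ≤ a / (4 * A) := by positivity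
      linarith
    refine ⟨fun i => (hqr t i).orth, fun i => ?_, fun i j => ?_⟩
    · have hinj : ∀ x, V t i *ᵥ x = 0 → x = 0 := fun x hx => by
        have h1 := hlow i x
        rw [hx, vecNorm_zero] at h1
        have h2 : 0 < a / (2 * A) := by positivity
        exact vecNorm_eq_zero.1 (by nlinarith [vecNorm_nonneg x])
      refine ((hM.tanLe_perturbed hb hη0 (by linarith) hT0 (hX' i) (hTan i) (hVη i)
        (hηA.trans_lt (by nlinarith))).of_isQR (hqr t i) hinj).mono ?_
      exact tan_step_le ha hq0 hq1 hm0 hm4 hs hbq hηA t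
    -- Both matrices are compared with the common ∑ M_j X_j, so the disagreement of the previous
    -- step does not enter.
    · have h1 : ‖V t j - V t i‖ ≤ 2 * δ * alpha M := by
        have h3 := norm_sub_le (V t j - ∑ j, M j * X t j) (V t i - ∑ j, M j * X t j)
        rw [sub_sub_sub_cancel_right] at h3
        linarith [hV t htn i, hV t htn j]
      have h2 : 12 * r * (2 * δ * alpha M) ≤ a / (2 * A) := by
        rw [le_div_iff₀ (by positivity), hα]
        have h4 : (r * A * D * δ) * 4 ≤ (r * A * D * δ) * (A * D) :=
          mul_le_mul_of_nonneg_left (by nlinarith) (by positivity)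
        have h6 : 12 * r * (2 * δ * (a * D)) * (2 * A) = a * (48 * (r * A * D * δ)) := by ring
        have h5 : 48 * (r * A * D * δ) ≤ 1 := by
          have : m = 29 * ((r * A * D * δ) * (A * D)) := by rw [hm]; ring
          have : 0 ≤ r * A * D * δ := by positivity
          linarith
        rw [h6]
        exact mul_le_of_le_one_right ha.le h5
      refine ((hqr t i).norm_sub_le (hqr t j) hr (by positivity) (hlow i) h1 h2).trans
        (le_of_eq ?_)
      rw [hα, hΔ]
      field_simp
      ring

end PerturbedIteration

/-! ### Spectral projection and eigenvalue bounds -/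

section Spectral

variable {N d r : ℕ}

lemma vecNorm_mono {v w : Fin d → ℝ} (h : ∀ i, |v i| ≤ |w i|) : vecNorm v ≤ vecNorm w := by
  refine Real.sqrt_le_sqrt (Finset.sum_le_sum fun i _ => ?_)
  rw [← pow_two, ← pow_two]
  exact sq_le_sq.2 (h i)

lemma vecNorm_smul {c : ℝ} (hc : 0 ≤ c) (v : Fin d → ℝ) : vecNorm (c • v) = c * vecNorm v := by
  simp only [vecNorm_eq_norm, WithLp.toLp_smul, norm_smul, Real.norm_eq_abs, abs_of_nonneg hc]

lemma IsEigensystem.mul_transpose {M : Matrix (Fin d) (Fin d) ℝ} {lam : Fin d → ℝ}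
    {U : Matrix (Fin d) (Fin d) ℝ} (h : IsEigensystem M lam U) : U * Uᵀ = 1 :=
  mul_eq_one_comm.1 h.orth

lemma IsEigensystem.mulVec_eq {M : Matrix (Fin d) (Fin d) ℝ} {lam : Fin d → ℝ}
    {U : Matrix (Fin d) (Fin d) ℝ} (h : IsEigensystem M lam U) (x : Fin d → ℝ) :
    M *ᵥ x = U *ᵥ (fun k => lam k * (Uᵀ *ᵥ x) k) := by
  have h1 : M = U * Matrix.diagonal lam * Uᵀ := by
    rw [← h.eig, Matrix.mul_assoc, h.mul_transpose, Matrix.mul_one]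
  conv_lhs => rw [h1, ← Matrix.mulVec_mulVec, ← Matrix.mulVec_mulVec]
  congr 1
  ext k
  rw [Matrix.mulVec_diagonal]

lemma IsEigensystem.mulVec_col {M : Matrix (Fin d) (Fin d) ℝ} {lam : Fin d → ℝ}
    {U : Matrix (Fin d) (Fin d) ℝ} (h : IsEigensystem M lam U) (k : Fin d) :
    M *ᵥ U.col k = lam k • U.col k := by
  ext i
  have := congrFun (congrFun h.eig i) k
  rw [Matrix.mul_diagonal, Matrix.mul_apply] at this
  simpa [Matrix.mulVec, dotProduct, mul_comm] using this

lemma IsEigensystem.col_dotProduct {M : Matrix (Fin d) (Fin d) ℝ} {lam : Fin d → ℝ}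
    {U : Matrix (Fin d) (Fin d) ℝ} (h : IsEigensystem M lam U) (j k : Fin d) :
    U.col j ⬝ᵥ U.col k = if j = k then 1 else 0 := by
  have := congrFun (congrFun h.orth j) k
  rw [Matrix.mul_apply, Matrix.one_apply] at this
  simpa [dotProduct] using this

lemma IsEigensystem.vecNorm_col {M : Matrix (Fin d) (Fin d) ℝ} {lam : Fin d → ℝ}
    {U : Matrix (Fin d) (Fin d) ℝ} (h : IsEigensystem M lam U) (k : Fin d) :
    vecNorm (U.col k) = 1 := by
  rw [vecNorm, h.col_dotProduct, if_pos rfl, Real.sqrt_one]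

lemma IsEigensystem.nonneg {M : Matrix (Fin d) (Fin d) ℝ} {lam : Fin d → ℝ}
    {U : Matrix (Fin d) (Fin d) ℝ} (h : IsEigensystem M lam U) (hM : M.PosSemidef) (k : Fin d) :
    0 ≤ lam k := by
  have h1 := hM.dotProduct_mulVec_nonneg (U.col k)
  rw [h.mulVec_col, dotProduct_smul, star_trivial, h.col_dotProduct, if_pos rfl] at h1
  simpa using h1

lemma IsEigensystem.le_norm {M : Matrix (Fin d) (Fin d) ℝ} {lam : Fin d → ℝ}
    {U : Matrix (Fin d) (Fin d) ℝ} (h : IsEigensystem M lam U) (hM : M.PosSemidef) (k : Fin d) :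
    lam k ≤ ‖M‖ := by
  have h1 := vecNorm_mulVec_le M (U.col k)
  rwa [h.mulVec_col, vecNorm_smul (h.nonneg hM k), h.vecNorm_col, mul_one, mul_one] at h1

/-- Although Q is known only through its span, this makes QQᵀ diagonal in the eigenbasis; later
estimates become coordinatewise. -/
lemma IsPrincipalBasis.proj_col {M : Matrix (Fin d) (Fin d) ℝ} {lam : Fin d → ℝ}
    {U : Matrix (Fin d) (Fin d) ℝ} {Q : Matrix (Fin d) (Fin r) ℝ} (h : IsEigensystem M lam U)
    (hQ : IsPrincipalBasis U Q) (k : Fin d) :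
    (Q * Qᵀ) *ᵥ U.col k = if (k : ℕ) < r then U.col k else 0 := by
  split_ifs with hk
  · have h1 : U.col k ∈ Submodule.span ℝ (Set.range fun k : Fin r => Q.col k) := by
      rw [hQ.span_eq]
      exact Submodule.subset_span ⟨k, hk, rfl⟩
    have h2 : U.col k ∈ LinearMap.range Q.mulVecLin := by
      rw [Matrix.range_mulVecLin]; exact h1
    obtain ⟨a, ha⟩ := h2
    rw [← ha, Matrix.mulVecLin_apply, Matrix.mulVec_mulVec, Matrix.mul_assoc, hQ.orth,
      Matrix.mul_one]
  · have h1 : ∀ v ∈ Submodule.span ℝ ((fun k : Fin d => U.col k) '' {k | (k : ℕ) < r}),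
        v ⬝ᵥ U.col k = 0 := by
      intro v hv
      induction hv using Submodule.span_induction with
      | mem v hv =>
        obtain ⟨j, hj, rfl⟩ := hv
        rw [h.col_dotProduct, if_neg]
        rintro rfl
        exact hk hj
      | zero => exact zero_dotProduct _
      | add v w _ _ hv hw => rw [add_dotProduct, hv, hw, add_zero]
      | smul c v _ hv => rw [smul_dotProduct, hv, smul_zero]
    rw [← hQ.span_eq] at h1
    have h2 : Qᵀ *ᵥ U.col k = 0 := by
      ext l
      exact h1 (Q.col l) (Submodule.subset_span ⟨l, rfl⟩)
    rw [← Matrix.mulVec_mulVec, h2, Matrix.mulVec_zero]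

lemma IsPrincipalBasis.proj_mulVec {M : Matrix (Fin d) (Fin d) ℝ} {lam : Fin d → ℝ}
    {U : Matrix (Fin d) (Fin d) ℝ} {Q : Matrix (Fin d) (Fin r) ℝ} (h : IsEigensystem M lam U)
    (hQ : IsPrincipalBasis U Q) (y : Fin d → ℝ) :
    (Q * Qᵀ) *ᵥ (U *ᵥ y) = U *ᵥ (fun k => if (k : ℕ) < r then y k else 0) := by
  have hU : ∀ z : Fin d → ℝ, U *ᵥ z = ∑ k, z k • U.col k := fun z => by
    ext i
    simp [Matrix.mulVec, dotProduct, mul_comm]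
  rw [hU, hU, Matrix.mulVec_sum]
  refine Finset.sum_congr rfl fun k _ => ?_
  rw [Matrix.mulVec_smul, hQ.proj_col h]
  split_ifs <;> simp

/-- The spectral projection onto the leading eigenvectors is dominant in the sense of
`IsDominant`. -/
lemma IsPrincipalBasis.isDominant {M : Matrix (Fin d) (Fin d) ℝ} {lam : Fin d → ℝ}
    {U : Matrix (Fin d) (Fin d) ℝ} {Q : Matrix (Fin d) (Fin r) ℝ} (h : IsEigensystem M lam U)
    (hM : M.PosSemidef) (hQ : IsPrincipalBasis U Q) (hr : 1 ≤ r) (hrd : r < d) (hr1 : r - 1 < d) :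
    IsDominant M Q (lam ⟨r - 1, hr1⟩) (lam ⟨r, hrd⟩) := by
  have hx : ∀ x : Fin d → ℝ, ∃ y, x = U *ᵥ y := fun x =>
    ⟨Uᵀ *ᵥ x, by rw [Matrix.mulVec_mulVec, h.mul_transpose, Matrix.one_mulVec]⟩
  have hMU : ∀ y : Fin d → ℝ, M *ᵥ (U *ᵥ y) = U *ᵥ (fun k => lam k * y k) := fun y => by
    rw [h.mulVec_eq, Matrix.mulVec_mulVec, h.orth, Matrix.one_mulVec]
  refine ⟨hQ.orth, fun x => ?_, fun x => ?_⟩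
  · obtain ⟨y, rfl⟩ := hx x
    rw [hMU, hQ.proj_mulVec h, hQ.proj_mulVec h, vecNorm_mulVec_of_orth h.orth,
      vecNorm_mulVec_of_orth h.orth, ← vecNorm_smul (h.nonneg hM _)]
    refine vecNorm_mono fun k => ?_
    simp only [Pi.smul_apply, smul_eq_mul]
    split_ifs with hk
    · rw [abs_mul, abs_mul, abs_of_nonneg (h.nonneg hM _), abs_of_nonneg (h.nonneg hM _)]
      refine mul_le_mul_of_nonneg_right (h.anti ?_) (abs_nonneg _)
      rw [Fin.le_def]
      change (k : ℕ) ≤ r - 1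
      omega
    · simp
  · obtain ⟨y, rfl⟩ := hx x
    rw [hMU, hQ.proj_mulVec h, hQ.proj_mulVec h, ← Matrix.mulVec_sub, ← Matrix.mulVec_sub,
      vecNorm_mulVec_of_orth h.orth,
      vecNorm_mulVec_of_orth h.orth, ← vecNorm_smul (h.nonneg hM _)]
    refine vecNorm_mono fun k => ?_
    simp only [Pi.smul_apply, smul_eq_mul, Pi.sub_apply]
    split_ifs with hk
    · simp
    · rw [sub_zero, sub_zero, abs_mul, abs_mul, abs_of_nonneg (h.nonneg hM _),
        abs_of_nonneg (h.nonneg hM _)]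
      refine mul_le_mul_of_nonneg_right (h.anti ?_) (abs_nonneg _)
      rw [Fin.le_def]
      change r ≤ (k : ℕ)
      omega

/-- Courant-Fischer: on every `r`-dimensional subspace `M` stretches some vector by at most its
`r`-th eigenvalue. -/
lemma IsEigensystem.exists_vecNorm_le {M : Matrix (Fin d) (Fin d) ℝ} {lam : Fin d → ℝ}
    {U : Matrix (Fin d) (Fin d) ℝ} (h : IsEigensystem M lam U) (hM : M.PosSemidef)
    (hr : 1 ≤ r) (hr1 : r - 1 < d)
    {X : Matrix (Fin d) (Fin r) ℝ} (hX : Xᵀ * X = 1) :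
    ∃ x ≠ 0, vecNorm ((M * X) *ᵥ x) ≤ lam ⟨r - 1, hr1⟩ * vecNorm x := by
  -- A kernel vector x of this (r−1)×r matrix makes Xx orthogonal to the first r−1 eigenvectors.
  let B : Matrix (Fin (r - 1)) (Fin r) ℝ :=
    (Uᵀ * X).submatrix (Fin.castLE (by omega)) id
  have hker : LinearMap.ker B.mulVecLin ≠ ⊥ := by
    apply LinearMap.ker_ne_bot_of_finrank_lt
    simp only [Module.finrank_fin_fun]
    omega
  obtain ⟨x, hx, hx0⟩ := Submodule.exists_mem_ne_zero_of_ne_bot hker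
  refine ⟨x, hx0, ?_⟩
  have hy : ∀ k : Fin d, (k : ℕ) < r - 1 → (Uᵀ *ᵥ (X *ᵥ x)) k = 0 := by
    intro k hk
    have h1 : B *ᵥ x = 0 := hx
    have h2 := congrFun h1 ⟨k, hk⟩
    rw [Matrix.mulVec_mulVec]
    exact h2
  have hn : vecNorm x = vecNorm (Uᵀ *ᵥ (X *ᵥ x)) := by
    have hU : Uᵀᵀ * Uᵀ = 1 := by rw [Matrix.transpose_transpose, h.mul_transpose]
    rw [vecNorm_mulVec_of_orth hU, vecNorm_mulVec_of_orth hX]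
  rw [← Matrix.mulVec_mulVec, h.mulVec_eq, vecNorm_mulVec_of_orth h.orth, hn,
    ← vecNorm_smul (h.nonneg hM _)]
  refine vecNorm_mono fun k => ?_
  simp only [Pi.smul_apply, smul_eq_mul]
  rw [abs_mul, abs_mul, abs_of_nonneg (h.nonneg hM _), abs_of_nonneg (h.nonneg hM _)]
  by_cases hk : (k : ℕ) < r - 1
  · rw [hy k hk]; simp
  · refine mul_le_mul_of_nonneg_right (h.anti ?_) (abs_nonneg _)
    rw [Fin.le_def]
    change r - 1 ≤ (k : ℕ)
    omega

end Spectral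

/-! ### The largest principal angle as a smallest singular value -/

section CosAngle

variable {d r : ℕ}

/-- Cauchy–Schwarz, with equality at y = XᵀQx; if that vector vanishes both sides are zero. -/
lemma iSup_cos_eq {Q X : Matrix (Fin d) (Fin r) ℝ} (hQ : Qᵀ * Q = 1)
    (hX : Xᵀ * X = 1) {x : Fin r → ℝ} (hx : x ≠ 0) :
    (⨆ y : {y : Fin r → ℝ // y ≠ 0},
      |(Q *ᵥ x) ⬝ᵥ (X *ᵥ y.1)| / (vecNorm (Q *ᵥ x) * vecNorm (X *ᵥ y.1))) =
      vecNorm ((Xᵀ * Q) *ᵥ x) / vecNorm x := by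
  have hxp := vecNorm_pos hx
  have hdot : ∀ y : Fin r → ℝ, (Q *ᵥ x) ⬝ᵥ (X *ᵥ y) = ((Xᵀ * Q) *ᵥ x) ⬝ᵥ y := fun y => by
    rw [dotProduct_comm, dotProduct_mulVec_transpose, Matrix.mulVec_mulVec, dotProduct_comm]
  have hle : ∀ y : {y : Fin r → ℝ // y ≠ 0},
      |(Q *ᵥ x) ⬝ᵥ (X *ᵥ y.1)| / (vecNorm (Q *ᵥ x) * vecNorm (X *ᵥ y.1)) ≤
      vecNorm ((Xᵀ * Q) *ᵥ x) / vecNorm x := fun y => by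
    have hyp := vecNorm_pos y.2
    rw [vecNorm_mulVec_of_orth hQ, vecNorm_mulVec_of_orth hX, hdot,
      div_le_div_iff₀ (by positivity) hxp]
    have := abs_dotProduct_le ((Xᵀ * Q) *ᵥ x) y.1
    nlinarith
  have : Nonempty {y : Fin r → ℝ // y ≠ 0} := ⟨⟨x, hx⟩⟩
  refine le_antisymm (ciSup_le hle) ?_
  by_cases h0 : (Xᵀ * Q) *ᵥ x = 0
  · rw [h0, vecNorm_zero, zero_div]
    exact Real.iSup_nonneg fun y => div_nonneg (abs_nonneg _)
      (mul_nonneg (vecNorm_nonneg _) (vecNorm_nonneg _))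
  · refine le_trans (le_of_eq ?_) (le_ciSup ⟨_, Set.forall_mem_range.2 hle⟩ ⟨(Xᵀ * Q) *ᵥ x, h0⟩)
    have hyp := vecNorm_pos h0
    simp only
    rw [vecNorm_mulVec_of_orth hQ, vecNorm_mulVec_of_orth hX, hdot, ← vecNorm_sq,
      abs_of_nonneg (by positivity)]
    field_simp

lemma cosAngle_eq {Q X : Matrix (Fin d) (Fin r) ℝ} (hQ : Qᵀ * Q = 1) (hX : Xᵀ * X = 1) :
    cosAngle Q X =
      ⨅ x : {x : Fin r → ℝ // x ≠ 0}, vecNorm ((Xᵀ * Q) *ᵥ x.1) / vecNorm x.1 := by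
  unfold cosAngle
  exact iInf_congr fun x => iSup_cos_eq hQ hX x.2

/-- The definition minimizes over ran Q, while the iteration needs a bound for vectors of ran X. The
two agree because QᵀX is square. -/
lemma cosAngle_mul_le {Q X : Matrix (Fin d) (Fin r) ℝ} (hQ : Qᵀ * Q = 1) (hX : Xᵀ * X = 1)
    (hs : 0 < cosAngle Q X) (x : Fin r → ℝ) :
    cosAngle Q X * vecNorm x ≤ vecNorm ((Qᵀ * X) *ᵥ x) := by
  have h1 : ∀ x, cosAngle Q X * vecNorm x ≤ vecNorm ((Xᵀ * Q) *ᵥ x) := fun x => by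
    by_cases hx : x = 0
    · simp [hx]
    rw [← le_div_iff₀ (vecNorm_pos hx), cosAngle_eq hQ hX]
    refine ciInf_le (f := fun x : {x : Fin r → ℝ // x ≠ 0} =>
      vecNorm ((Xᵀ * Q) *ᵥ x.1) / vecNorm x.1) ⟨0, Set.forall_mem_range.2 fun y => ?_⟩ ⟨x, hx⟩
    exact div_nonneg (vecNorm_nonneg _) (vecNorm_nonneg _)
  have h2 := lower_bound_transpose (Xᵀ * Q) hs h1 x
  rwa [Matrix.transpose_mul, Matrix.transpose_transpose] at h2

lemma cosAngle_mul_le_proj {Q X : Matrix (Fin d) (Fin r) ℝ} (hQ : Qᵀ * Q = 1)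
    (hX : Xᵀ * X = 1) (hs : 0 < cosAngle Q X) (x : Fin r → ℝ) :
    cosAngle Q X * vecNorm x ≤ vecNorm ((Q * Qᵀ) *ᵥ (X *ᵥ x)) := by
  rw [← Matrix.mulVec_mulVec, vecNorm_mulVec_of_orth hQ, Matrix.mulVec_mulVec]
  exact cosAngle_mul_le hQ hX hs x

lemma exists_ne_zero_vec (hr : 1 ≤ r) : ∃ x : Fin r → ℝ, x ≠ 0 :=
  ⟨fun _ => 1, fun h => one_ne_zero (congrFun h ⟨0, hr⟩)⟩

lemma cosAngle_le_one {Q X : Matrix (Fin d) (Fin r) ℝ} (hr : 1 ≤ r) (hQ : Qᵀ * Q = 1)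
    (hX : Xᵀ * X = 1) (hs : 0 < cosAngle Q X) : cosAngle Q X ≤ 1 := by
  obtain ⟨x, hx⟩ := exists_ne_zero_vec hr
  have h1 := (cosAngle_mul_le_proj hQ hX hs x).trans (vecNorm_proj_le hQ _)
  rw [vecNorm_mulVec_of_orth hX] at h1
  have := vecNorm_pos hx
  nlinarith

/-- The factor 2 avoids showing that the infimum is attained: otherwise transposition would give 2
cos θ ≤ cos θ. -/
lemma exists_vecNorm_proj_le_cosAngle {Q X : Matrix (Fin d) (Fin r) ℝ} (hr : 1 ≤ r)
    (hQ : Qᵀ * Q = 1) (hX : Xᵀ * X = 1) (hs : 0 < cosAngle Q X) :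
    ∃ x ≠ 0, vecNorm ((Q * Qᵀ) *ᵥ (X *ᵥ x)) ≤ 2 * cosAngle Q X * vecNorm x := by
  by_contra! hcon
  have h1 : ∀ x, 2 * cosAngle Q X * vecNorm x ≤ vecNorm ((Qᵀ * X) *ᵥ x) := fun x => by
    by_cases hx : x = 0
    · simp [hx]
    have := hcon x hx
    rw [← Matrix.mulVec_mulVec, vecNorm_mulVec_of_orth hQ, Matrix.mulVec_mulVec] at this
    exact this.le
  have h2 := lower_bound_transpose (Qᵀ * X) (by positivity) h1
  rw [Matrix.transpose_mul, Matrix.transpose_transpose] at h2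
  obtain ⟨x, hx⟩ := exists_ne_zero_vec hr
  have : Nonempty {x : Fin r → ℝ // x ≠ 0} := ⟨⟨x, hx⟩⟩
  have h3 : 2 * cosAngle Q X ≤ cosAngle Q X := by
    nth_rw 2 [cosAngle_eq hQ hX]
    exact le_ciInf fun x => (le_div_iff₀ (vecNorm_pos x.2)).2 (h2 x.1)
  linarith

end CosAngle

/-! ### Lower bounds for β -/

section Conditioning

variable {N d r : ℕ}

lemma norm_sum_le_alpha (M : Fin N → Matrix (Fin d) (Fin d) ℝ) : ‖∑ i, M i‖ ≤ alpha M :=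
  norm_sum_le _ _

/-- Only the first factor is used: R⁽¹⁾ has the same singular values as M Q_init, and ‖(R⁽¹⁾)⁻¹‖ ≤
β. -/
lemma IsOIRun.vecNorm_le_beta_mul {M : Matrix (Fin d) (Fin d) ℝ}
    {X : Matrix (Fin d) (Fin r) ℝ} {Qc : ℕ → Matrix (Fin d) (Fin r) ℝ}
    {Rc : ℕ → Matrix (Fin r) (Fin r) ℝ} (h : IsOIRun M X Qc Rc) {n : ℕ} (hn : 1 ≤ n)
    (hinj : ∀ x, (M * X) *ᵥ x = 0 → x = 0) (x : Fin r → ℝ) :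
    vecNorm x ≤ beta Rc n * vecNorm ((M * X) *ᵥ x) := by
  have h1 := h.step 0
  rw [h.init, zero_add] at h1
  have hd : IsUnit (Rc 1).det := (Matrix.isUnit_iff_isUnit_det _).1 (h1.isUnit hinj)
  have h2 : ‖(Rc 1)⁻¹‖ ≤ beta Rc n :=
    le_ciSup (f := fun t : Fin n => ‖(Rc ((t : ℕ) + 1))⁻¹‖) (Set.finite_range _).bddAbove
      ⟨0, hn⟩
  have h3 : (Rc 1)⁻¹ *ᵥ (Rc 1 *ᵥ x) = x := by
    rw [Matrix.mulVec_mulVec, Matrix.nonsing_inv_mul _ hd, Matrix.one_mulVec]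
  rw [h1.vecNorm_eq]
  calc vecNorm x = vecNorm ((Rc 1)⁻¹ *ᵥ (Rc 1 *ᵥ x)) := by rw [h3]
    _ ≤ ‖(Rc 1)⁻¹‖ * vecNorm (Rc 1 *ᵥ x) := vecNorm_mulVec_le _ _
    _ ≤ _ := mul_le_mul_of_nonneg_right h2 (vecNorm_nonneg _)

lemma beta_nonneg (Rc : ℕ → Matrix (Fin r) (Fin r) ℝ) (n : ℕ) : 0 ≤ beta Rc n :=
  Real.iSup_nonneg fun _ => norm_nonneg _

lemma IsDominant.injective_mul {M : Matrix (Fin d) (Fin d) ℝ} {Q X : Matrix (Fin d) (Fin r) ℝ}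
    {a b s : ℝ} (hM : IsDominant M Q a b) (ha : 0 < a) (hs : 0 < s)
    (hs₀ : ∀ x, s * vecNorm x ≤ vecNorm ((Q * Qᵀ) *ᵥ (X *ᵥ x))) (x : Fin r → ℝ)
    (hx : (M * X) *ᵥ x = 0) : x = 0 := by
  have h1 := hM.low (X *ᵥ x)
  rw [Matrix.mulVec_mulVec x M X, hx, Matrix.mulVec_zero, vecNorm_zero] at h1
  have h2 := hs₀ x
  have h3 : vecNorm ((Q * Qᵀ) *ᵥ (X *ᵥ x)) ≤ 0 := by
    by_contra! h; nlinarith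
  exact vecNorm_eq_zero.1 (le_antisymm (by by_contra! h; nlinarith) (vecNorm_nonneg x))

/-- The condition number `α β` compares with the spectral radius over the `r`-th eigenvalue. -/
lemma IsOIRun.one_le_beta_mul {M : Matrix (Fin d) (Fin d) ℝ} {lam : Fin d → ℝ}
    {U : Matrix (Fin d) (Fin d) ℝ} (h : IsEigensystem M lam U) (hM : M.PosSemidef)
    (hr : 1 ≤ r) (hr1 : r - 1 < d)
    {X : Matrix (Fin d) (Fin r) ℝ} (hX : Xᵀ * X = 1)
    {Qc : ℕ → Matrix (Fin d) (Fin r) ℝ}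
    {Rc : ℕ → Matrix (Fin r) (Fin r) ℝ} (hrun : IsOIRun M X Qc Rc) {n : ℕ} (hn : 1 ≤ n)
    (hinj : ∀ x, (M * X) *ᵥ x = 0 → x = 0) :
    1 ≤ beta Rc n * lam ⟨r - 1, hr1⟩ := by
  obtain ⟨x, hx, hxM⟩ := h.exists_vecNorm_le hM hr hr1 hX
  have h1 := hrun.vecNorm_le_beta_mul hn hinj x
  have h2 := mul_le_mul_of_nonneg_left hxM (beta_nonneg Rc n)
  have h3 := vecNorm_pos hx
  by_contra! h4
  nlinarith

/-- If the initial angle is close to a right angle and the spectral gap ratio is small, then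
`α β` is large. -/
lemma IsOIRun.one_le_beta_mul_cosAngle {M : Matrix (Fin d) (Fin d) ℝ}
    {Q X : Matrix (Fin d) (Fin r) ℝ} {a b : ℝ} (hM : IsDominant M Q a b) (hr : 1 ≤ r)
    (hb : 0 ≤ b) (hX : Xᵀ * X = 1) (hs : 0 < cosAngle Q X)
    (hQM : ∀ x, M *ᵥ ((Q * Qᵀ) *ᵥ x) = (Q * Qᵀ) *ᵥ (M *ᵥ x))
    {Qc : ℕ → Matrix (Fin d) (Fin r) ℝ}
    {Rc : ℕ → Matrix (Fin r) (Fin r) ℝ} (hrun : IsOIRun M X Qc Rc) {n : ℕ} (hn : 1 ≤ n)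
    (hinj : ∀ x, (M * X) *ᵥ x = 0 → x = 0) :
    1 ≤ beta Rc n * (‖M‖ * (2 * cosAngle Q X) + b) := by
  obtain ⟨x, hx, hxQ⟩ := exists_vecNorm_proj_le_cosAngle hr hM.orth hX hs
  have h1 := hrun.vecNorm_le_beta_mul hn hinj x
  -- For x almost attaining the angle, the part of Xx in ran Q has length at most 2 cos θ ‖x‖, and M
  -- stretches the complementary part by at most b.
  have h2 : vecNorm ((M * X) *ᵥ x) ≤ (‖M‖ * (2 * cosAngle Q X) + b) * vecNorm x := by
    rw [← Matrix.mulVec_mulVec]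
    refine (vecNorm_le_add_sub _ ((Q * Qᵀ) *ᵥ (M *ᵥ (X *ᵥ x)))).trans ?_
    have e1 := hM.high (X *ᵥ x)
    have e2 := vecNorm_sub_proj_le hM.orth (X *ᵥ x)
    rw [vecNorm_mulVec_of_orth hX] at e2
    have e3 := vecNorm_mulVec_le M ((Q * Qᵀ) *ᵥ (X *ᵥ x))
    rw [hQM] at e3
    have e4 := mul_le_mul_of_nonneg_left hxQ (norm_nonneg M)
    have e5 := mul_le_mul_of_nonneg_left e2 hb
    linarith
  have h3 := mul_le_mul_of_nonneg_left h2 (beta_nonneg Rc n)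
  have h4 := vecNorm_pos hx
  by_contra! h5
  nlinarith

lemma IsPrincipalBasis.proj_comm {M : Matrix (Fin d) (Fin d) ℝ} {lam : Fin d → ℝ}
    {U : Matrix (Fin d) (Fin d) ℝ} {Q : Matrix (Fin d) (Fin r) ℝ} (h : IsEigensystem M lam U)
    (hQ : IsPrincipalBasis U Q) (x : Fin d → ℝ) :
    M *ᵥ ((Q * Qᵀ) *ᵥ x) = (Q * Qᵀ) *ᵥ (M *ᵥ x) := by
  obtain ⟨y, rfl⟩ : ∃ y, x = U *ᵥ y :=
    ⟨Uᵀ *ᵥ x, by rw [Matrix.mulVec_mulVec, h.mul_transpose, Matrix.one_mulVec]⟩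
  have hMU : ∀ y : Fin d → ℝ, M *ᵥ (U *ᵥ y) = U *ᵥ (fun k => lam k * y k) := fun y => by
    rw [h.mulVec_eq, Matrix.mulVec_mulVec, h.orth, Matrix.one_mulVec]
  rw [hMU, hQ.proj_mulVec h, hQ.proj_mulVec h, hMU]
  congr 1
  ext k
  split_ifs <;> simp

end Conditioning

/-! ### Consensus averaging and mixing of W -/

section Mixing

variable {N d r : ℕ}

lemma consensus_eq (G : SimpleGraph (Fin N)) {W : Matrix (Fin N) (Fin N) ℝ}
    (hG : ∀ i j, j ≠ i → ¬ G.Adj i j → W i j = 0) (Z : Fin N → Matrix (Fin d) (Fin r) ℝ)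
    (k : ℕ) (i : Fin N) : consensus G W Z k i = ∑ j, (W ^ k) i j • Z j := by
  classical
  induction k generalizing i with
  | zero => simp [consensus, Matrix.one_apply]
  | succ k ih =>
    have h1 : consensus G W Z (k + 1) i = ∑ j, W i j • consensus G W Z k j := by
      simp only [consensus]
      refine Finset.sum_subset (Finset.subset_univ _) fun j _ hj => ?_
      simp only [Finset.mem_filter, Finset.mem_univ, true_and, not_or] at hj
      rw [hG i j hj.1 hj.2, zero_smul]
    rw [h1]
    simp_rw [ih, Finset.smul_sum, smul_smul]
    rw [Finset.sum_comm]
    refine Finset.sum_congr rfl fun j _ => ?_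
    rw [← Finset.sum_smul, pow_succ', Matrix.mul_apply]

lemma normalizer_eq [NeZero N] (W : Matrix (Fin N) (Fin N) ℝ) (k : ℕ) (i : Fin N) :
    normalizer W k i = (W ^ k) i 0 := by
  simp [normalizer]

/-- If `W ^ k` is entrywise close to averaging, the normalized consensus iterate is close to the
sum of the initial values. -/
lemma consensus_error [NeZero N] (G : SimpleGraph (Fin N)) {W : Matrix (Fin N) (Fin N) ℝ}
    (hG : ∀ i j, j ≠ i → ¬ G.Adj i j → W i j = 0) (Z : Fin N → Matrix (Fin d) (Fin r) ℝ)
    {k : ℕ} {e : ℝ} (he : ∀ i j, |(W ^ k) i j - 1 / N| ≤ e) (hNe : 4 * N * e ≤ 1) (i : Fin N) :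
    0 < normalizer W k i ∧
      ‖(normalizer W k i)⁻¹ • consensus G W Z k i - ∑ j, Z j‖ ≤ 4 * N * e * ∑ j, ‖Z j‖ := by
  have hN : (0 : ℝ) < N := by exact_mod_cast Nat.pos_of_ne_zero (NeZero.ne N)
  have he0 : 0 ≤ e := (abs_nonneg _).trans (he 0 0)
  have hlow : 1 / (2 * N) ≤ (W ^ k) i 0 := by
    have h1 := (abs_le.1 (he i 0)).1
    have h2 : e ≤ 1 / (2 * N) := by rw [le_div_iff₀ (by positivity)]; linarith
    have h3 : 1 / (N : ℝ) = 1 / (2 * N) + 1 / (2 * N) := by field_simp; norm_num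
    linarith
  have hpos : 0 < (W ^ k) i 0 := lt_of_lt_of_le (by positivity) hlow
  rw [normalizer_eq, consensus_eq G hG]
  refine ⟨hpos, ?_⟩
  rw [Finset.smul_sum, ← Finset.sum_sub_distrib, Finset.mul_sum]
  refine norm_sum_le_of_le _ fun j _ => ?_
  have h1 : ((W ^ k) i 0)⁻¹ • (W ^ k) i j • Z j - Z j =
      (((W ^ k) i 0)⁻¹ * ((W ^ k) i j - (W ^ k) i 0)) • Z j := by
    rw [mul_sub, inv_mul_cancel₀ hpos.ne', sub_smul, one_smul, smul_smul]
  rw [h1, norm_smul]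
  refine mul_le_mul_of_nonneg_right ?_ (norm_nonneg _)
  rw [Real.norm_eq_abs, abs_mul, abs_of_pos (inv_pos.2 hpos)]
  -- The relative deviation of each weight from the normalizer is at most 2e divided by 1/(2N), that
  -- is 4Ne.
  have h2 : |(W ^ k) i j - (W ^ k) i 0| ≤ 2 * e := by
    have h3 := abs_le.1 (he i j)
    have h4 := abs_le.1 (he i 0)
    rw [abs_le]
    constructor <;> linarith [h3.1, h3.2, h4.1, h4.2]
  have h3 : ((W ^ k) i 0)⁻¹ ≤ 2 * N := by
    rw [inv_le_comm₀ hpos (by positivity), ← one_div]; exact hlow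
  calc _ ≤ 2 * N * (2 * e) := mul_le_mul h3 h2 (abs_nonneg _) (by positivity)
    _ = _ := by ring

/-- Powers of a primitive doubly stochastic matrix converge geometrically to averaging. -/
lemma exists_mixing_rate [NeZero N] {W : Matrix (Fin N) (Fin N) ℝ}
    (hW : W ∈ doublyStochastic ℝ (Fin N)) (hp : W.IsPrimitive) :
    ∃ a K : ℝ, 0 < a ∧ 0 < K ∧
      ∀ (k : ℕ) (i j : Fin N), |(W ^ k) i j - 1 / N| ≤ K * Real.exp (-(a * k)) := by
  have hN : (0 : ℝ) < N := by exact_mod_cast Nat.pos_of_ne_zero (NeZero.ne N)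
  have hWk : ∀ k, W ^ k ∈ doublyStochastic ℝ (Fin N) := fun k => pow_mem hW k
  have hcontr : ∀ (B : Matrix (Fin N) (Fin N) ℝ) (η : ℝ), B ∈ doublyStochastic ℝ (Fin N) →
      (∀ i j, η ≤ B i j) → ∀ (k : ℕ) (i : Fin N),
      ∑ j, |(W ^ k * B) i j - 1 / N| ≤ (1 - N * η) * ∑ j, |(W ^ k) i j - 1 / N| := by
    intro B η hB hη k i
    have h0 : ∑ l, ((W ^ k) i l - 1 / (N : ℝ)) = 0 := by
      rw [Finset.sum_sub_distrib, sum_row_of_mem_doublyStochastic (hWk k)]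
      simp [hN.ne']
    -- Doeblin's argument: deviations in a row sum to zero, so η may be subtracted from every entry
    -- of B, which lowers its row sums to 1 − Nη.
    have h1 : ∀ j, (W ^ k * B) i j - 1 / N =
        ∑ l, ((W ^ k) i l - 1 / N) * (B l j - η) := by
      intro j
      have h2 : ∑ l, ((W ^ k) i l - 1 / (N : ℝ)) * (B l j - η) =
          ∑ l, (W ^ k) i l * B l j - 1 / N * ∑ l, B l j -
            (∑ l, ((W ^ k) i l - 1 / (N : ℝ))) * η := by
        rw [Finset.mul_sum, Finset.sum_mul, ← Finset.sum_sub_distrib, ← Finset.sum_sub_distrib]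
        exact Finset.sum_congr rfl fun l _ => by ring
      rw [h2, h0, sum_col_of_mem_doublyStochastic hB, Matrix.mul_apply]
      ring
    calc ∑ j, |(W ^ k * B) i j - 1 / N|
        ≤ ∑ j, ∑ l, |(W ^ k) i l - 1 / N| * (B l j - η) := by
          refine Finset.sum_le_sum fun j _ => ?_
          rw [h1]
          refine (Finset.abs_sum_le_sum_abs _ _).trans (le_of_eq ?_)
          refine Finset.sum_congr rfl fun l _ => ?_
          rw [abs_mul, abs_of_nonneg (sub_nonneg.2 (hη l j))]
      _ = ∑ l, |(W ^ k) i l - 1 / N| * (1 - N * η) := by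
          rw [Finset.sum_comm]
          refine Finset.sum_congr rfl fun l _ => ?_
          rw [← Finset.mul_sum, Finset.sum_sub_distrib, sum_row_of_mem_doublyStochastic hB]
          simp
      _ = _ := by rw [← Finset.sum_mul, mul_comm]
  obtain ⟨n, hn, hpos⟩ := hp.exists_pos_pow
  obtain ⟨η, hη0, hη⟩ : ∃ η : ℝ, 0 < η ∧ ∀ i j, η ≤ (W ^ n) i j := by
    obtain ⟨p, hp⟩ := Finite.exists_min (fun p : Fin N × Fin N => (W ^ n) p.1 p.2)
    exact ⟨_, hpos p.1 p.2, fun i j => hp (i, j)⟩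
  have hstep : ∀ k i, ∑ j, |(W ^ (k + 1)) i j - 1 / (N : ℝ)| ≤
      ∑ j, |(W ^ k) i j - 1 / (N : ℝ)| := fun k i => by
    have := hcontr W 0 hW (fun i j => nonneg_of_mem_doublyStochastic hW) k i
    rwa [mul_zero, sub_zero, one_mul, ← pow_succ] at this
  have hstepn : ∀ k i, ∑ j, |(W ^ (k + n)) i j - 1 / (N : ℝ)| ≤
      Real.exp (-(N * η)) * ∑ j, |(W ^ k) i j - 1 / (N : ℝ)| := fun k i => by
    have := hcontr (W ^ n) η (hWk n) hη k i
    rw [← pow_add] at this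
    refine this.trans (mul_le_mul_of_nonneg_right ?_ (Finset.sum_nonneg fun _ _ => abs_nonneg _))
    have := Real.add_one_le_exp (-(N * η))
    linarith
  have hinit : ∀ i, ∑ j, |(W ^ 0) i j - 1 / (N : ℝ)| ≤ 2 := fun i => by
    calc _ ≤ ∑ j, ((W ^ 0) i j + 1 / (N : ℝ)) := by
          refine Finset.sum_le_sum fun j _ => ?_
          refine (abs_sub _ _).trans (le_of_eq ?_)
          rw [abs_of_nonneg (nonneg_of_mem_doublyStochastic (hWk 0)), abs_of_nonneg (by positivity)]
      _ = 2 := by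
          rw [Finset.sum_add_distrib, sum_row_of_mem_doublyStochastic (hWk 0)]
          simp [hN.ne']
          norm_num
  have hn0 : (0 : ℝ) < n := by exact_mod_cast hn
  -- Each block of n powers gains exp(−Nη); the prefactor pays for an incomplete block and the
  -- initial ℓ¹ deviation, at most 2.
  refine ⟨N * η / n, 2 * Real.exp (N * η), by positivity, by positivity, fun k i j => ?_⟩
  have hbound : ∀ (k : ℕ) (i : Fin N), ∑ j, |(W ^ k) i j - 1 / (N : ℝ)| ≤
      2 * Real.exp (N * η) * Real.exp (-(N * η / n * k)) := by
    intro k i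
    induction k using Nat.strong_induction_on with
    | _ k ih =>
      rcases lt_or_ge k n with hk | hk
      · have h1 : ∑ j, |(W ^ k) i j - 1 / (N : ℝ)| ≤ 2 := by
          refine le_trans ?_ (hinit i)
          exact antitone_nat_of_succ_le (f := fun k => ∑ j, |(W ^ k) i j - 1 / (N : ℝ)|)
            (fun k => hstep k i) (Nat.zero_le k)
        have h2 : 1 ≤ Real.exp (N * η) * Real.exp (-(N * η / n * k)) := by
          rw [← Real.exp_add]
          refine Real.one_le_exp ?_
          have hk' : (k : ℝ) ≤ n := by exact_mod_cast hk.le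
          have : N * η / n * k ≤ N * η / n * n := mul_le_mul_of_nonneg_left hk' (by positivity)
          rw [div_mul_cancel₀ _ hn0.ne'] at this
          linarith
        linarith
      · obtain ⟨l, rfl⟩ := Nat.exists_eq_add_of_le' hk
        refine (hstepn l i).trans
          ((mul_le_mul_of_nonneg_left (ih l (by omega)) (Real.exp_pos _).le).trans (le_of_eq ?_))
        rw [mul_left_comm, ← Real.exp_add]
        congr 2
        push_cast
        field_simp
        ring
  exact (Finset.single_le_sum (f := fun j => |(W ^ k) i j - 1 / (N : ℝ)|)
    (fun j _ => abs_nonneg _) (Finset.mem_univ j)).trans (hbound k i)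

/-- The mixing time is positive unless the network consists of a single node. -/
lemma one_le_mixingTime [NeZero N] {W : Matrix (Fin N) (Fin N) ℝ}
    (hW : W ∈ doublyStochastic ℝ (Fin N)) (hp : W.IsPrimitive) (hN2 : 2 ≤ N) :
    1 ≤ mixingTime W := by
  have hN : (2 : ℝ) ≤ N := by exact_mod_cast hN2
  obtain ⟨a, K, ha, hK, h⟩ := exists_mixing_rate hW hp
  refine le_trans ?_ (le_ciSup (Set.finite_range _).bddAbove (0 : Fin N))
  -- Nonemptiness matters because the infimum of the empty set is 0. Time 0 is excluded since (1−u)²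
  -- + u² ≥ 1/2 > 1/4 for u = 1/N.
  refine le_csInf ?_ fun t ht => ?_
  · have h1 : Filter.Tendsto (fun k : ℕ => N * (K * Real.exp (-(a * k)))) Filter.atTop
        (nhds (N * (K * 0))) := by
      refine (Filter.Tendsto.const_mul _ (Filter.Tendsto.const_mul _ ?_))
      exact Real.tendsto_exp_neg_atTop_nhds_zero.comp
        (tendsto_natCast_atTop_atTop.const_mul_atTop ha)
    rw [mul_zero, mul_zero] at h1
    obtain ⟨k, hk⟩ := (h1.eventually (ge_mem_nhds (by norm_num : (0 : ℝ) < 1 / 2))).exists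
    refine ⟨k, ?_⟩
    have hb : 0 ≤ K * Real.exp (-(a * k)) := by positivity
    refine le_trans ?_ hk
    refine Real.sqrt_le_iff.2 ⟨by positivity, ?_⟩
    calc ∑ j, ((W ^ k) 0 j - 1 / (N : ℝ)) ^ 2 ≤ ∑ _j : Fin N, (K * Real.exp (-(a * k))) ^ 2 := by
          refine Finset.sum_le_sum fun j _ => ?_
          rw [← sq_abs]
          exact pow_le_pow_left₀ (abs_nonneg _) (h k 0 j) 2
      _ = N * (K * Real.exp (-(a * k))) ^ 2 := by simp
      _ ≤ (N * (K * Real.exp (-(a * k)))) ^ 2 := by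
          have hNN : (N : ℝ) ≤ (N : ℝ) ^ 2 := by nlinarith
          rw [mul_pow (N : ℝ)]
          exact mul_le_mul_of_nonneg_right hNN (sq_nonneg _)
  · by_contra! h0
    obtain rfl : t = 0 := by omega
    have h1 : Real.sqrt (∑ j, ((W ^ 0) (0 : Fin N) j - 1 / (N : ℝ)) ^ 2) ≤ 1 / 2 := ht
    rw [Real.sqrt_le_left (by norm_num)] at h1
    have h2 := Finset.single_le_sum (f := fun j => ((W ^ 0) (0 : Fin N) j - 1 / (N : ℝ)) ^ 2)
      (fun j _ => sq_nonneg _) (Finset.mem_univ 0)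
    have h3 := h2.trans h1
    obtain ⟨j, hj⟩ : ∃ j : Fin N, j ≠ 0 := ⟨⟨1, hN2⟩, by simp [Fin.ext_iff]⟩
    have h4 : ((W ^ 0) (0 : Fin N) 0 - 1 / (N : ℝ)) ^ 2 + ((W ^ 0) (0 : Fin N) j - 1 / (N : ℝ)) ^ 2
        ≤ (1 / 2) ^ 2 := by
      refine le_trans ?_ h1
      rw [← Finset.sum_pair hj.symm (f := fun j => ((W ^ 0) (0 : Fin N) j - 1 / (N : ℝ)) ^ 2)]
      exact Finset.sum_le_sum_of_subset_of_nonneg (Finset.subset_univ _) fun _ _ _ => sq_nonneg _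
    rw [pow_zero, Matrix.one_apply_eq, Matrix.one_apply_ne hj.symm] at h4
    nlinarith [sq_nonneg (1 - 2 * (1 / (N : ℝ)))]

end Mixing

/-! ### Error bound and number of rounds -/

section ErrorBound

variable {N d r : ℕ}

/-- The factor in front of the spectral gap ratio, as a function of the cosine of the largest
initial principal angle. -/
noncomputable def angleFactor (s : ℝ) : ℝ := 1 + 4 / |s| + 2 * (1 / |s|) ^ (1 / |s|)

lemma angleFactor_pos (s : ℝ) : 0 < angleFactor s := by
  have h1 : 0 ≤ (1 / |s|) ^ (1 / |s|) := Real.rpow_nonneg (by positivity) _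
  have h2 : 0 ≤ 4 / |s| := by positivity
  unfold angleFactor
  linarith

lemma four_div_mul_pow_le_angleFactor {s q : ℝ} (hs : 0 < s) (hq : 0 ≤ q) (n : ℕ) :
    4 / s * q ^ n ≤ angleFactor s * q ^ n := by
  refine mul_le_mul_of_nonneg_right ?_ (by positivity)
  have h1 : 0 ≤ (1 / |s|) ^ (1 / |s|) := Real.rpow_nonneg (by positivity) _
  unfold angleFactor
  rw [abs_of_pos hs] at *
  linarith

/-- Handles the few iterations during which s cannot be controlled by κn: there q^n ≥ s^n ≥ s^(1/s),
which dictates the last term of `angleFactor`. -/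
lemma two_le_angleFactor_mul_pow {s q : ℝ} (hs : 0 < s) (hs1 : s ≤ 1) {n : ℕ}
    (hn : (n : ℝ) ≤ 1 / s) (hsq : s ≤ q) : 2 ≤ angleFactor s * q ^ n := by
  have h1 : 1 ≤ 1 / s := by rw [le_div_iff₀ hs]; linarith
  have h2 : (1 / s) ^ n ≤ (1 / s) ^ (1 / s) := by
    rw [← Real.rpow_natCast]
    exact Real.rpow_le_rpow_of_exponent_le h1 hn
  have h3 : s ^ n ≤ q ^ n := pow_le_pow_left₀ hs.le hsq n
  have h4 : 1 ≤ (1 / s) ^ (1 / s) * q ^ n := by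
    calc (1 : ℝ) = (1 / s) ^ n * s ^ n := by rw [← mul_pow, one_div_mul_cancel hs.ne', one_pow]
      _ ≤ _ := mul_le_mul h2 h3 (by positivity) (by positivity)
  have h5 : 0 ≤ (1 + 4 / s) * q ^ n := by
    have := hs.trans_le hsq
    positivity
  unfold angleFactor
  rw [abs_of_pos hs]
  linarith

/-- Everything is absorbed into w = κn ≥ 3: n ≤ w, ρD² ≤ w²/9 and 1/s ≤ w, the last because q < s
turns the gap hypothesis into κs ≥ 1. This costs w^5, and the constant 3712/9 ≤ 3^6 costs w^6,
whence the exponent 11. -/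
lemma accumulated_error_le {n : ℕ} {D s q κ δ E ρ : ℝ} (hn : 1 ≤ n) (hs : 0 < s)
    (hρ : 0 ≤ ρ) (hD : 0 ≤ D) (hκ : 3 ≤ κ) (hρD : 3 * Real.sqrt ρ * D ≤ κ)
    (hgap : 3 ≤ κ * (2 * s + q)) (hδ0 : 0 ≤ δ) (hδ : δ ≤ E / (κ * n) ^ 11)
    (hcase : 1 / s < n ∨ q < s) : 8 * n * (29 * ρ * (4 / s) ^ 2 * D ^ 2 * δ) ≤ E := by
  have hn' : (1 : ℝ) ≤ n := by exact_mod_cast hn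
  set w := κ * n with hw
  have hκw : κ ≤ w := le_mul_of_one_le_right (by linarith) hn'
  have hnw : n ≤ w := le_mul_of_one_le_left (by linarith) (by linarith)
  have hw3 : 3 ≤ w := hκ.trans hκw
  have hsw : 1 / s ≤ w := by
    rcases hcase with h | h
    · exact h.le.trans hnw
    · refine le_trans ?_ hκw
      rw [div_le_iff₀ hs]
      nlinarith
  have h1 : ρ * D ^ 2 ≤ w ^ 2 / 9 := by
    have h2 : (3 * Real.sqrt ρ * D) ^ 2 ≤ w ^ 2 :=
      pow_le_pow_left₀ (by positivity) (hρD.trans hκw) 2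
    have h3 := Real.sq_sqrt hρ
    have h4 : (3 * Real.sqrt ρ * D) ^ 2 = 9 * (ρ * D ^ 2) := by
      rw [mul_pow, mul_pow, h3]; ring
    linarith
  have h2 : (1 / s) ^ 2 ≤ w ^ 2 := pow_le_pow_left₀ (by positivity) hsw 2
  have hE : δ * w ^ 11 ≤ E := (le_div_iff₀ (by positivity)).1 hδ
  calc 8 * n * (29 * ρ * (4 / s) ^ 2 * D ^ 2 * δ)
      = 3712 * (n * ((ρ * D ^ 2) * ((1 / s) ^ 2 * δ))) := by ring
    _ ≤ 3712 * (w * ((w ^ 2 / 9) * (w ^ 2 * δ))) := by gcongr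
    _ ≤ δ * w ^ 5 * 3 ^ 6 := by
        have : 0 ≤ δ * w ^ 5 := by positivity
        linarith
    _ ≤ δ * w ^ 5 * w ^ 6 := by gcongr
    _ = δ * w ^ 11 := by ring
    _ ≤ E := hE

lemma posSemidef_sum {M : Fin N → Matrix (Fin d) (Fin d) ℝ} (hM : ∀ i, (M i).PosSemidef) :
    (∑ i, M i).PosSemidef :=
  Matrix.posSemidef_sum _ fun i _ => hM i

/-- Lower bounds for the condition number `3 √r α β`. -/
lemma IsOIRun.condition_bounds {M : Fin N → Matrix (Fin d) (Fin d) ℝ}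
    (hM : ∀ i, (M i).PosSemidef) {lam : Fin d → ℝ} {U : Matrix (Fin d) (Fin d) ℝ}
    {Q X : Matrix (Fin d) (Fin r) ℝ} {Qc : ℕ → Matrix (Fin d) (Fin r) ℝ}
    {Rc : ℕ → Matrix (Fin r) (Fin r) ℝ} (hr : 1 ≤ r) (hrd : r < d) (hr1 : r - 1 < d)
    (h : IsEigensystem (∑ i, M i) lam U)
    (hgap : lam ⟨r, hrd⟩ < lam ⟨r - 1, hr1⟩) (hQ : IsPrincipalBasis U Q)
    (hX : Xᵀ * X = 1) (hs : 0 < cosAngle Q X) (hrun : IsOIRun (∑ i, M i) X Qc Rc) {n : ℕ}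
    (hn : 1 ≤ n) :
    3 * Real.sqrt r * (alpha M / lam ⟨r - 1, hr1⟩) ≤
        3 * Real.sqrt r * alpha M * beta Rc n ∧
      3 ≤ 3 * Real.sqrt r * alpha M * beta Rc n ∧
      3 ≤ 3 * Real.sqrt r * alpha M * beta Rc n *
        (2 * cosAngle Q X + lam ⟨r, hrd⟩ / lam ⟨r - 1, hr1⟩) := by
  have hS := posSemidef_sum hM
  have hdom := hQ.isDominant h hS hr hrd hr1
  have hb := h.nonneg hS ⟨r, hrd⟩
  have haM := (h.le_norm hS ⟨r - 1, hr1⟩).trans (norm_sum_le_alpha M)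
  have hMα := norm_sum_le_alpha M
  set a := lam ⟨r - 1, hr1⟩ with ha_def
  set b := lam ⟨r, hrd⟩
  set s := cosAngle Q X
  set α := alpha M
  set β := beta Rc n
  have ha : 0 < a := hb.trans_lt hgap
  have hα : 0 < α := ha.trans_le haM
  have hinj := hdom.injective_mul ha hs (cosAngle_mul_le_proj hQ.orth hX hs)
  have h1 : 1 ≤ β * a := hrun.one_le_beta_mul h hS hr hr1 hX hn hinj
  have h2 := hrun.one_le_beta_mul_cosAngle hdom hr hb hX hs (hQ.proj_comm h) hn hinj
  have hβ : 0 ≤ β := beta_nonneg Rc n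
  have hsr : 1 ≤ Real.sqrt r := Real.one_le_sqrt.2 (by exact_mod_cast hr)
  have h3 : α / a ≤ α * β := by
    rw [div_le_iff₀ ha, mul_assoc]
    exact le_mul_of_one_le_right hα.le h1
  have h4 : 1 ≤ α / a := by rw [le_div_iff₀ ha]; linarith
  have h5 : 1 ≤ α * β * (2 * s + b / a) := by
    have h6 : b ≤ α * (b / a) := by
      rw [mul_div_assoc', le_div_iff₀ ha, mul_comm]
      exact mul_le_mul_of_nonneg_right haM hb
    refine h2.trans ?_
    calc β * (‖∑ i, M i‖ * (2 * s) + b) ≤ β * (α * (2 * s) + α * (b / a)) := by gcongr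
      _ = _ := by ring
  refine ⟨?_, ?_, ?_⟩
  · rw [mul_assoc (3 * Real.sqrt r) α β]
    gcongr
  · have := mul_le_mul hsr (h4.trans h3) zero_le_one (by linarith)
    linarith
  · have := mul_le_mul hsr h5 zero_le_one (by linarith)
    linarith

lemma distributed_step_error [NeZero N] {G : SimpleGraph (Fin N)}
    {W : Matrix (Fin N) (Fin N) ℝ} (hG : ∀ i j, j ≠ i → ¬ G.Adj i j → W i j = 0)
    (M : Fin N → Matrix (Fin d) (Fin d) ℝ) {X : Fin N → Matrix (Fin d) (Fin r) ℝ}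
    (hX : ∀ i, (X i)ᵀ * X i = 1) {k : ℕ} {e : ℝ} (he : ∀ i j, |(W ^ k) i j - 1 / N| ≤ e)
    (hNe : 4 * N * e ≤ 1) (i : Fin N) :
    ‖(normalizer W k i)⁻¹ • consensus G W (fun j => M j * X j) k i - ∑ j, M j * X j‖ ≤
      4 * N * e * alpha M := by
  have he0 : 0 ≤ e := (abs_nonneg _).trans (he 0 0)
  refine (consensus_error G hG _ he hNe i).2.trans (mul_le_mul_of_nonneg_left ?_ (by positivity))
  refine Finset.sum_le_sum fun j _ => (Matrix.l2_opNorm_mul _ _).trans ?_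
  exact mul_le_of_le_one_right (norm_nonneg _) (norm_le_one_of_orth (hX j))

/-- Error bound for distributed orthogonal iteration in terms of the distance of the consensus
weights from exact averaging. -/
lemma IsDistributedRun.error_le [NeZero N] {G : SimpleGraph (Fin N)}
    {W : Matrix (Fin N) (Fin N) ℝ} (hG : ∀ i j, j ≠ i → ¬ G.Adj i j → W i j = 0)
    {M : Fin N → Matrix (Fin d) (Fin d) ℝ}
    (hM : ∀ i, (M i).PosSemidef) {lam : Fin d → ℝ} {U : Matrix (Fin d) (Fin d) ℝ}
    {Q X : Matrix (Fin d) (Fin r) ℝ} {Qc : ℕ → Matrix (Fin d) (Fin r) ℝ}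
    {Rc : ℕ → Matrix (Fin r) (Fin r) ℝ} (hr : 1 ≤ r) (hrd : r < d) (hr1 : r - 1 < d)
    (h : IsEigensystem (∑ i, M i) lam U)
    (hgap : lam ⟨r, hrd⟩ < lam ⟨r - 1, hr1⟩) (hQ : IsPrincipalBasis U Q)
    (hX : Xᵀ * X = 1) (hs : 0 < cosAngle Q X) (hrun : IsOIRun (∑ i, M i) X Qc Rc) {n : ℕ}
    (hn : 1 ≤ n) {ε : ℝ} (hε : 0 < ε) (hε1 : ε < 1) {Tc : ℕ → ℕ}
    {Qs : ℕ → Fin N → Matrix (Fin d) (Fin r) ℝ} {Rs : ℕ → Fin N → Matrix (Fin r) (Fin r) ℝ}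
    (hdist : IsDistributedRun G W M Tc X Qs Rs) {e : ℝ}
    (he : ∀ t ∈ Set.Icc 1 n, ∀ i j, |(W ^ Tc t) i j - 1 / N| ≤ e)
    (hsmall : 4 * N * e ≤ ε ^ n / (3 * Real.sqrt r * alpha M * beta Rc n * n) ^ 11) :
    (∀ t ∈ Set.Icc 1 n, ∀ i, 0 < normalizer W (Tc t) i) ∧
      ∀ i, ‖Q * Qᵀ - Qs n i * (Qs n i)ᵀ‖ ≤
        angleFactor (cosAngle Q X) * |lam ⟨r, hrd⟩ / lam ⟨r - 1, hr1⟩| ^ n + 2 * ε ^ n := by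
  obtain ⟨hκ1, hκ2, hκ3⟩ := hrun.condition_bounds hM hr hrd hr1 h hgap hQ hX hs hn
  have hS := posSemidef_sum hM
  have hdom := hQ.isDominant h hS hr hrd hr1
  have hb := h.nonneg hS ⟨r, hrd⟩
  have haα := (h.le_norm hS ⟨r - 1, hr1⟩).trans (norm_sum_le_alpha M)
  have hs1 := cosAngle_le_one hr hQ.orth hX hs
  have hs₀ := cosAngle_mul_le_proj hQ.orth hX hs
  set κ := 3 * Real.sqrt r * alpha M * beta Rc n
  set a := lam ⟨r - 1, hr1⟩ with ha_def
  set b := lam ⟨r, hrd⟩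
  set s := cosAngle Q X
  have ha : 0 < a := hb.trans_lt hgap
  have hn' : (1 : ℝ) ≤ n := by exact_mod_cast hn
  have he0 : 0 ≤ e := (abs_nonneg _).trans (he n ⟨hn, le_rfl⟩ 0 0)
  have hεn : ε ^ n ≤ 1 := pow_le_one₀ hε.le hε1.le
  have hεn0 : 0 < ε ^ n := by positivity
  have hNe : 4 * N * e ≤ 1 := by
    refine hsmall.trans ?_
    have h1 : 1 ≤ κ * n := by nlinarith
    exact div_le_one_of_le₀ (hεn.trans (one_le_pow₀ h1)) (by positivity)
  refine ⟨fun t ht i => (consensus_error G hG (fun _ => (0 : Matrix (Fin d) (Fin r) ℝ))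
    (he t ht) hNe i).1, fun i => ?_⟩
  have hq0 : 0 ≤ b / a := by positivity
  rw [abs_of_nonneg hq0]
  have hortho : ∀ t i, (Qs t i)ᵀ * Qs t i = 1 := fun t i => by
    cases t with
    | zero => rw [hdist.init]; exact hX
    | succ t => exact (hdist.step t i).orth
  -- In the first case the distance of two projections, at most 2, is already small enough;
  -- otherwise 1/s is controlled by κn.
  by_cases hcase : (n : ℝ) ≤ 1 / s ∧ s ≤ b / a
  · have h1 := two_le_angleFactor_mul_pow hs hs1 hcase.1 hcase.2
    have h2 := norm_proj_sub_le_two hQ.orth (hortho n i)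
    linarith
  · have hcase' : 1 / s < n ∨ b / a < s := by
      by_contra! h1
      exact hcase h1
    have hacc := accumulated_error_le hn hs (Nat.cast_nonneg r)
      (div_nonneg (ha.le.trans haα) ha.le) hκ2 hκ1 hκ3 (by positivity) hsmall hcase'
    set m := 29 * r * (4 / s) ^ 2 * (alpha M / a) ^ 2 * (4 * N * e) with hm
    have hm0 : 0 ≤ m := by positivity
    have hmn : 4 * n * m ≤ 1 := by
      have : 0 ≤ n * m := by positivity
      linarith
    obtain ⟨-, hTan, -⟩ := tanLe_of_inexact_iteration hdom hr ha haα hb hgap.le hs hs1 hX hs₀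
      (by positivity) hm hmn hdist.init hdist.step
      (fun t ht i => distributed_step_error hG M (hortho t) (he (t + 1) ⟨by omega, by omega⟩) hNe i)
      n le_rfl
    have hpow : (1 + 2 * m) ^ n ≤ 2 := by
      have h1 : (1 + 2 * m) ^ n ≤ Real.exp (2 * m) ^ n :=
        pow_le_pow_left₀ (by positivity) (by linarith [Real.add_one_le_exp (2 * m)]) n
      rw [← Real.exp_nat_mul] at h1
      have h2 : Real.exp (n * (2 * m)) ≤ Real.exp (1 / 2) := Real.exp_le_exp.2 (by linarith)
      have h3 : Real.exp (1 / 2) ≤ 2 := by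
        rw [← Real.le_log_iff_exp_le (by norm_num)]
        linarith [Real.log_two_gt_d9]
      exact h1.trans (h2.trans h3)
    have hTle : (1 + 2 * m) ^ n * ((b / a) ^ n / s + n * m) ≤ 2 * ((b / a) ^ n / s + n * m) :=
      mul_le_mul_of_nonneg_right hpow (by positivity)
    have h1 := ((hTan i).mono hTle).norm_proj_sub_le hQ.orth (hortho n i) (by positivity)
    have h2 := four_div_mul_pow_le_angleFactor hs hq0 n
    have h3 : 2 * (2 * ((b / a) ^ n / s + n * m)) = 4 / s * (b / a) ^ n + 4 * n * m := by ring
    have h4 : 0 ≤ n * m := by positivity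
    linarith

/-- Cauchy–Schwarz over the nodes. It makes the logarithm containing γ nonnegative. -/
lemma one_le_gamma_mul_sqrt_div_alpha [NeZero N] (hr : 1 ≤ r)
    {M : Fin N → Matrix (Fin d) (Fin d) ℝ} (hα : 0 < alpha M) :
    1 ≤ gamma M * Real.sqrt (N * r) / alpha M := by
  rw [le_div_iff₀ hα, one_mul, gamma, ← Real.sqrt_mul (Finset.sum_nonneg fun _ _ => sq_nonneg _)]
  refine Real.le_sqrt_of_sq_le ?_
  have h1 : (∑ i, ‖M i‖) ^ 2 ≤ N * ∑ i, ‖M i‖ ^ 2 := by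
    simpa using sq_sum_le_card_mul_sum_sq (s := Finset.univ) (f := fun i => ‖M i‖)
  have hr' : (1 : ℝ) ≤ r := by exact_mod_cast hr
  have h2 : 0 ≤ ∑ i, ‖M i‖ ^ 2 := Finset.sum_nonneg fun _ _ => sq_nonneg _
  calc alpha M ^ 2 ≤ N * ∑ i, ‖M i‖ ^ 2 := h1
    _ ≤ (N * ∑ i, ‖M i‖ ^ 2) * r := le_mul_of_one_le_right (by positivity) hr'
    _ = _ := by ring

/-- The number of consensus rounds required in either scheme makes the geometric mixing error
small. -/
lemma mixing_error_le {a K B κ ε T : ℝ} {n N : ℕ} (ha : 0 < a) (hB : 0 ≤ B)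
    (hKB : 4 * N * K ≤ Real.exp B) (hκ : 3 ≤ κ) (hε : 0 < ε) (hε1 : ε < 1) (hn : 1 ≤ n)
    (hT : (11 + B) / a * (Real.log κ + n * Real.log (1 / ε) + Real.log n) ≤ T) :
    4 * N * (K * Real.exp (-(a * T))) ≤ ε ^ n / (κ * n) ^ 11 := by
  have hn0 : (0 : ℝ) < n := by exact_mod_cast hn
  have hlogκ : 1 ≤ Real.log κ := by
    rw [Real.le_log_iff_exp_le (by linarith)]
    linarith [Real.exp_one_lt_d9]
  have hlogε : 0 ≤ Real.log (1 / ε) :=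
    Real.log_nonneg (by rw [le_div_iff₀ hε]; linarith)
  have hlogn : 0 ≤ Real.log n := Real.log_nonneg (by exact_mod_cast hn)
  set L := Real.log κ + n * Real.log (1 / ε) + Real.log n with hL
  have hL1 : 1 ≤ L := by
    have : 0 ≤ n * Real.log (1 / ε) := by positivity
    linarith
  -- As L ≥ 1, the factor 11 + B pays for 11L, hence for (κn)^11, and for the prefactor 4NK ≤ exp B.
  have haT : 11 * L + B ≤ a * T := by
    have h1 : (11 + B) * L ≤ a * T := by
      have := mul_le_mul_of_nonneg_left hT ha.le
      rwa [← mul_assoc, mul_div_cancel₀ _ ha.ne'] at this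
    nlinarith
  have hexpL : Real.exp (-L) = ε ^ n / (κ * n) := by
    rw [hL, one_div, Real.log_inv, neg_add, neg_add, Real.exp_add, Real.exp_add, mul_neg, neg_neg,
      Real.exp_neg, Real.exp_neg, Real.exp_log (by linarith), Real.exp_log hn0, Real.exp_nat_mul,
      Real.exp_log hε]
    field_simp
  have hεn : ε ^ n ≤ 1 := pow_le_one₀ hε.le hε1.le
  have hεn0 : 0 < ε ^ n := by positivity
  calc 4 * N * (K * Real.exp (-(a * T))) = 4 * N * K * Real.exp (-(a * T)) := by ring
    _ ≤ Real.exp B * Real.exp (-(a * T)) := mul_le_mul_of_nonneg_right hKB (Real.exp_pos _).le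
    _ ≤ Real.exp (-L) ^ 11 := by
        rw [← Real.exp_add, ← Real.exp_nat_mul]
        refine Real.exp_le_exp.2 ?_
        push_cast
        linarith
    _ = (ε ^ n) ^ 11 / (κ * n) ^ 11 := by rw [hexpL, div_pow]
    _ ≤ _ := by
        refine div_le_div_of_nonneg_right ?_ (by positivity)
        exact pow_le_of_le_one hεn0.le hεn (by norm_num)

/-- The term log n is absorbed by the n−1 spare copies of log κ: log n ≤ n − 1 and log κ ≥ 1. -/
lemma sdot_rounds_ge {κ ε Γ τ : ℝ} {n : ℕ} (hκ : 3 ≤ κ) (hε : 0 < ε) (hε1 : ε < 1)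
    (hn : 1 ≤ n) (hΓ : 1 ≤ Γ) (hτ : 1 ≤ τ) :
    Real.log κ + n * Real.log (1 / ε) + Real.log n ≤
      n * τ * Real.log κ + n * τ * Real.log (1 / ε) + τ * Real.log Γ := by
  have hn0 : (1 : ℝ) ≤ n := by exact_mod_cast hn
  have hlogκ : 1 ≤ Real.log κ := by
    rw [Real.le_log_iff_exp_le (by linarith)]
    linarith [Real.exp_one_lt_d9]
  have hlogε : 0 ≤ Real.log (1 / ε) :=
    Real.log_nonneg (by rw [le_div_iff₀ hε]; linarith)
  have hlogΓ := Real.log_nonneg hΓ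
  have hlogn := Real.log_le_sub_one_of_pos (by linarith : (0 : ℝ) < n)
  have h1 : n * Real.log κ * 1 ≤ n * Real.log κ * τ :=
    mul_le_mul_of_nonneg_left hτ (by positivity)
  have h2 : n * Real.log (1 / ε) * 1 ≤ n * Real.log (1 / ε) * τ :=
    mul_le_mul_of_nonneg_left hτ (by positivity)
  have h3 : 0 ≤ τ * Real.log Γ := by positivity
  have h4 : (n - 1 : ℝ) * 1 ≤ (n - 1) * Real.log κ :=
    mul_le_mul_of_nonneg_left hlogκ (by linarith)
  linarith

/-- At t = 1 only one copy of log κ is guaranteed, so log n has to come from log(nΓ). -/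
lemma sadot_rounds_ge {κ ε Γ τ : ℝ} {n t : ℕ} (hκ : 3 ≤ κ) (hε : 0 < ε) (hε1 : ε < 1)
    (hn : 1 ≤ n) (ht : 1 ≤ t) (hΓ : 1 ≤ Γ) (hτ : 1 ≤ τ) :
    Real.log κ + n * Real.log (1 / ε) + Real.log n ≤
      t * τ * Real.log κ + n * τ * Real.log (1 / ε) + τ * Real.log (n * Γ) := by
  have hn0 : (1 : ℝ) ≤ n := by exact_mod_cast hn
  have ht0 : (1 : ℝ) ≤ t := by exact_mod_cast ht
  have hlogκ : 0 ≤ Real.log κ := Real.log_nonneg (by linarith)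
  have hlogε : 0 ≤ Real.log (1 / ε) :=
    Real.log_nonneg (by rw [le_div_iff₀ hε]; linarith)
  have hlogn := Real.log_nonneg hn0
  have h1 : 1 * Real.log κ ≤ t * τ * Real.log κ :=
    mul_le_mul_of_nonneg_right (by nlinarith) hlogκ
  have h2 : n * Real.log (1 / ε) * 1 ≤ n * Real.log (1 / ε) * τ :=
    mul_le_mul_of_nonneg_left hτ (by positivity)
  have h3 : Real.log n ≤ Real.log (n * Γ) :=
    Real.log_le_log (by linarith) (le_mul_of_one_le_right (by linarith) hΓ)
  have h4 : 1 * Real.log (n * Γ) ≤ τ * Real.log (n * Γ) :=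
    mul_le_mul_of_nonneg_right hτ (hlogn.trans h3)
  linarith

lemma pow_apply_of_subsingleton [NeZero N] {W : Matrix (Fin N) (Fin N) ℝ}
    (hW : W ∈ doublyStochastic ℝ (Fin N)) (hN : N = 1) (k : ℕ) (i j : Fin N) :
    |(W ^ k) i j - 1 / N| ≤ 0 := by
  subst hN
  have h := sum_row_of_mem_doublyStochastic (pow_mem hW k) i
  rw [Fin.sum_univ_one] at h
  rw [Subsingleton.elim j 0, h]
  simp

/-- A number of consensus rounds of the form required by both schemes suffices for the
consensus error needed in `IsDistributedRun.error_le`. -/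
lemma exists_rounds_constant [NeZero N] {W : Matrix (Fin N) (Fin N) ℝ}
    (hW : W ∈ doublyStochastic ℝ (Fin N)) (hp : W.IsPrimitive) :
    ∃ C : ℝ, 0 < C ∧ ∀ (κ ε : ℝ) (n : ℕ), 3 ≤ κ → 0 < ε → ε < 1 → 1 ≤ n →
      ∃ e : ℝ, 4 * N * e ≤ ε ^ n / (κ * n) ^ 11 ∧
        ∀ (k : ℕ) (L : ℝ),
          (1 ≤ (mixingTime W : ℝ) →
            Real.log κ + n * Real.log (1 / ε) + Real.log n ≤ L) →
          C * L ≤ k → ∀ i j, |(W ^ k) i j - 1 / N| ≤ e := by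
  -- A single node has mixing time 0, so the round count carries no information, but W^k is then
  -- exact averaging and e = 0 works.
  by_cases hN : N = 1
  · refine ⟨1, one_pos, fun κ ε n hκ hε _ hn => ⟨0, ?_, fun k _ _ _ i j =>
      pow_apply_of_subsingleton hW hN k i j⟩⟩
    have : 0 < κ := by linarith
    rw [mul_zero]
    positivity
  · have hN2 : 2 ≤ N := by
      have := NeZero.ne N
      omega
    have hτ : 1 ≤ (mixingTime W : ℝ) := by exact_mod_cast one_le_mixingTime hW hp hN2
    obtain ⟨a, K, ha, hK, hmix⟩ := exists_mixing_rate hW hp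
    have hKB : 4 * N * K ≤ Real.exp (4 * N * K) := by
      linarith [Real.add_one_le_exp (4 * N * K)]
    have hB : 0 ≤ 4 * N * K := by positivity
    have hC : 0 < (11 + 4 * N * K) / a := by positivity
    refine ⟨_, hC, fun κ ε n hκ hε hε1 hn => ?_⟩
    refine ⟨K * Real.exp (-(a * ((11 + 4 * N * K) / a *
      (Real.log κ + n * Real.log (1 / ε) + Real.log n)))),
      mixing_error_le ha hB hKB hκ hε hε1 hn le_rfl, fun k L hL hk i j => ?_⟩
    refine (hmix k i j).trans (mul_le_mul_of_nonneg_left (Real.exp_le_exp.2 ?_) hK.le)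
    refine neg_le_neg (mul_le_mul_of_nonneg_left ?_ ha.le)
    exact (mul_le_mul_of_nonneg_left (hL hτ) hC.le).trans hk

end ErrorBound

end DOT

/-! ### The theorem -/

theorem theorem1 :
    -- `c` depends on the initial angle only
    ∃ c : ℝ → ℝ, (∀ x, 0 < c x) ∧
    ∀ (N : ℕ) [NeZero N] (W : Matrix (Fin N) (Fin N) ℝ),
      W ∈ doublyStochastic ℝ (Fin N) → W.IsPrimitive →
    -- `C` is the constant hidden in the two lower bounds on the numbers of consensus rounds
    ∃ C : ℝ, 0 < C ∧
    ∀ (G : SimpleGraph (Fin N)), (∀ i j, j ≠ i → ¬ G.Adj i j → W i j = 0) →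
    ∀ (d r : ℕ) (hr : 1 ≤ r) (hrd : r < d)
      (M : Fin N → Matrix (Fin d) (Fin d) ℝ), (∀ i, (M i).PosSemidef) →
    ∀ (lam : Fin d → ℝ) (U : Matrix (Fin d) (Fin d) ℝ) (Q Qinit : Matrix (Fin d) (Fin r) ℝ)
      (Qc : ℕ → Matrix (Fin d) (Fin r) ℝ) (Rc : ℕ → Matrix (Fin r) (Fin r) ℝ)
      (To : ℕ) (ε : ℝ),
      DOT.IsEigensystem (∑ i, M i) lam U →
      lam ⟨r, hrd⟩ < lam ⟨r - 1, by omega⟩ →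
      DOT.IsPrincipalBasis U Q →
      Qinitᵀ * Qinit = 1 →
      0 < DOT.cosAngle Q Qinit →
      DOT.IsOIRun (∑ i, M i) Qinit Qc Rc →
      1 ≤ To → 0 < ε → ε < 1 →
      -- S-DOT
      (∀ (Tc : ℕ) (Qs : ℕ → Fin N → Matrix (Fin d) (Fin r) ℝ)
          (Rs : ℕ → Fin N → Matrix (Fin r) (Fin r) ℝ),
        DOT.IsSDOTRun G W M Tc Qinit Qs Rs →
        C * (To * DOT.mixingTime W *
                Real.log (3 * Real.sqrt r * DOT.alpha M * DOT.beta Rc To)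
              + To * DOT.mixingTime W * Real.log (1 / ε)
              + DOT.mixingTime W *
                Real.log (DOT.gamma M * Real.sqrt (N * r) / DOT.alpha M)) ≤ (Tc : ℝ) →
        (∀ i, 0 < DOT.normalizer W Tc i) ∧
        ∀ i, ‖Q * Qᵀ - Qs To i * (Qs To i)ᵀ‖ ≤
          c (DOT.cosAngle Q Qinit) * |lam ⟨r, hrd⟩ / lam ⟨r - 1, by omega⟩| ^ To
            + 3 * ε ^ To) ∧
      -- SA-DOT
      (∀ (Tc : ℕ → ℕ) (Qs : ℕ → Fin N → Matrix (Fin d) (Fin r) ℝ)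
          (Rs : ℕ → Fin N → Matrix (Fin r) (Fin r) ℝ),
        DOT.IsSADOTRun G W M To Tc Qinit Qs Rs →
        (∀ t ∈ Set.Icc 1 To,
          C * (t * DOT.mixingTime W *
                  Real.log (3 * Real.sqrt r * DOT.alpha M * DOT.beta Rc To)
                + To * DOT.mixingTime W * Real.log (1 / ε)
                + DOT.mixingTime W *
                  Real.log (To * (DOT.gamma M * Real.sqrt (N * r) / DOT.alpha M)))
            ≤ (Tc t : ℝ)) →
        (∀ t ∈ Set.Icc 1 To, ∀ i, 0 < DOT.normalizer W (Tc t) i) ∧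
        ∀ i, ‖Q * Qᵀ - Qs To i * (Qs To i)ᵀ‖ ≤
          c (DOT.cosAngle Q Qinit) * |lam ⟨r, hrd⟩ / lam ⟨r - 1, by omega⟩| ^ To
            + 2 * ε ^ To) := by
  refine ⟨DOT.angleFactor, DOT.angleFactor_pos, fun N _ W hW hp => ?_⟩
  obtain ⟨C, hC, hrounds⟩ := DOT.exists_rounds_constant hW hp
  refine ⟨C, hC, ?_⟩
  intro G hG d r hr hrd M hM lam U Q Qinit Qc Rc To ε hE hgap hQ hinit hcos hOI hTo hε hε1
  have hr1 : r - 1 < d := by omega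
  have hκ := (hOI.condition_bounds hM hr hrd hr1 hE hgap hQ hinit hcos hTo).2.1
  have hS := DOT.posSemidef_sum hM
  have hα : 0 < DOT.alpha M :=
    ((hE.nonneg hS ⟨r, hrd⟩).trans_lt hgap).trans_le
      ((hE.le_norm hS _).trans (DOT.norm_sum_le_alpha M))
  have hΓ := DOT.one_le_gamma_mul_sqrt_div_alpha hr hα
  obtain ⟨e, he, hmix⟩ := hrounds _ ε To hκ hε hε1 hTo
  refine ⟨fun Tc Qs Rs hrun hT => ?_, fun Tc Qs Rs hrun hT => ?_⟩
  · have hW' := hmix Tc _ (fun hτ => DOT.sdot_rounds_ge hκ hε hε1 hTo hΓ hτ) hT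
    obtain ⟨hpos, herr⟩ := DOT.IsDistributedRun.error_le hG hM hr hrd hr1 hE hgap hQ hinit hcos hOI
      hTo hε hε1 hrun (fun _ _ => hW') he
    -- The number of rounds is constant, so t = 1 gives positivity; the error bound holds even with
    -- 2ε^n in place of 3ε^n.
    refine ⟨hpos 1 ⟨le_rfl, hTo⟩, fun i => (herr i).trans ?_⟩
    have : 0 < ε ^ To := by positivity
    linarith
  · exact DOT.IsDistributedRun.error_le hG hM hr hrd hr1 hE hgap hQ hinit hcos hOI
      hTo hε hε1 hrun.2 (fun t ht => hmix (Tc t) _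
        (fun hτ => DOT.sadot_rounds_ge hκ hε hε1 hTo ht.1 hΓ hτ) (hT t ht)) he
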